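/- Let $GL(n)$ act by left multiplication on the symmetric space $GL(n)/O(n)$, i.e. on the set of inner products on $\mathbb R^n$ (the coset $A\,O(n)$ corresponds to $\langle A^{-1}\cdot,A^{-1}\cdot\rangle$); this action is by isometries. Call two subsets of $GL(n)/O(n)$ congruent if some isometry given by an element $\varphi\in GL(n)$ maps one onto the other. A left-invariant Riemannian metric $g$ on a Lie group is a Ricci soliton if $\operatorname{Ric}(g)+\tfrac12\mathcal L_Xg=c\,g$ for some smooth vector field $X$ and some $c\in\mathbb R$. A 2-step nilpotent Lie algebra $\mathfrak g$ is of type $(p,q)$ if $\dim[\mathfrak g,\mathfrak g]=p\ge 1$ and $\dim\mathfrak g=p+q$. **Theorem A.** There exists a connected 9-dimensional nilpotent Lie group $G$, whose Lie algebra $\mathfrak g$ is 2-step nilpotent of type $(4,5)$, such that 1. $G$ admits a left-invariant Ricci soliton metric (a nilsoliton), and 2. for every identification $\mathfrak g\cong\mathbb R^9$ by a basis, the subgroup $\mathbb R^{>0}\times\operatorname{Aut}(\mathfrak g)_0\subset GL(9)$, generated by the positive multiples of the identity and the identity component of the automorphism group of $\mathfrak g$, does not act transitively on $GL(9)/O(9)$,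 and any two of its orbits in $GL(9)/O(9)$ are congruent. In particular, $G$ is a counterexample to the version of the Taketomi–Tamaru conjecture for the connected group $\mathbb R^{>0}\times\operatorname{Aut}(\mathfrak g)_0$, according to which a nilpotent Lie group admits no left-invariant Ricci soliton metric if this group is not transitive on $GL(n)/O(n)$ and all of its orbits are congruent. -/

import Mathlib

open scoped Manifold ContDiff Bundle Pointwise Matrix

noncomputable section

/-! ### Left-invariant Ricci solitons on Lie groups -/

section RicciSoliton

variable {E : Type*} [NormedAddCommGroup E] [NormedSpace ℝ E] [FiniteDimensional ℝ E]
  {G : Type*} [TopologicalSpace G] [ChartedSpace E G] [Group G] [LieGroup 𝓘(ℝ, E) ∞ G]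

/-- A smooth Lie group is regular enough for Mathlib's Lie algebra structure on its tangent space
at the identity. -/
instance lieGroup_minSmoothness : LieGroup 𝓘(ℝ, E) (minSmoothness ℝ 3) G := by
  rw [minSmoothness_of_isRCLikeNormedField]
  exact LieGroup.of_le (n := ∞) ENat.LEInfty.out

/-- A smooth Riemannian metric on the Lie group `G`. -/
abbrev SmoothMetric (E : Type*) [NormedAddCommGroup E] [NormedSpace ℝ E]
    (G : Type*) [TopologicalSpace G] [ChartedSpace E G] [Group G] [LieGroup 𝓘(ℝ, E) ∞ G] : Type _ :=
  Bundle.ContMDiffRiemannianMetric 𝓘(ℝ, E) ∞ E (fun x : G ↦ TangentSpace 𝓘(ℝ, E) x)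

/-- All left translations are isometries. -/
def IsLeftInvariant (g : SmoothMetric E G) : Prop :=
  ∀ (a x : G) (v w : TangentSpace 𝓘(ℝ, E) x),
    g.inner (a * x) (mfderiv 𝓘(ℝ, E) 𝓘(ℝ, E) (fun y ↦ a * y) x v)
      (mfderiv 𝓘(ℝ, E) 𝓘(ℝ, E) (fun y ↦ a * y) x w) = g.inner x v w

/-- Affine connections on `G`. In Mathlib's notation `D Y x (X x)` is `(∇_X Y)(x)`. -/
abbrev AffineConnection (E : Type*) [NormedAddCommGroup E] [NormedSpace ℝ E]
    (G : Type*) [TopologicalSpace G] [ChartedSpace E G] [Group G] [LieGroup 𝓘(ℝ, E) ∞ G] : Type _ :=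
  CovariantDerivative 𝓘(ℝ, E) E (TangentSpace 𝓘(ℝ, E) : G → Type _)

/-- `D` is the Levi-Civita connection of `g`: it is torsion free, and it is compatible with `g`, that
is, `v (g(Y,Z)) = g(∇_v Y, Z) + g(Y, ∇_v Z)`. -/
def IsLeviCivita (g : SmoothMetric E G) (D : AffineConnection E G) : Prop :=
  D.torsion = 0 ∧
  ∀ (Y Z : Π x : G, TangentSpace 𝓘(ℝ, E) x) (x : G),
    MDifferentiableAt 𝓘(ℝ, E) 𝓘(ℝ, E).tangent
      (fun y ↦ (⟨y, Y y⟩ : TangentBundle 𝓘(ℝ, E) G)) x →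
    MDifferentiableAt 𝓘(ℝ, E) 𝓘(ℝ, E).tangent
      (fun y ↦ (⟨y, Z y⟩ : TangentBundle 𝓘(ℝ, E) G)) x →
    ∀ v : TangentSpace 𝓘(ℝ, E) x,
      mvfderiv 𝓘(ℝ, E) (fun y ↦ g.inner y (Y y) (Z y)) x v
        = g.inner x (D Y x v) (Z x) + g.inner x (Y x) (D Z x v)

/-- The curvature `R(X,Y)Z = ∇_X ∇_Y Z - ∇_Y ∇_X Z - ∇_{[X,Y]} Z` at the point `x`. -/
def curvature (D : AffineConnection E G) (X Y Z : Π x : G, TangentSpace 𝓘(ℝ, E) x) (x : G) :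
    TangentSpace 𝓘(ℝ, E) x :=
  D (fun y ↦ D Z y (Y y)) x (X x) - D (fun y ↦ D Z y (X y)) x (Y x)
    - D Z x (VectorField.mlieBracket 𝓘(ℝ, E) X Y x)

/-- The Ricci tensor `Ric(Y,Z) = ∑ i, g(R(e i, Y) Z, e i)`, the trace of `V ↦ R(V,Y)Z` computed
in the frame `e`, which has to be orthonormal for `g`. -/
def ricci {ι : Type*} [Fintype ι] (g : SmoothMetric E G) (D : AffineConnection E G)
    (e : ι → Π x : G, TangentSpace 𝓘(ℝ, E) x)
    (Y Z : Π x : G, TangentSpace 𝓘(ℝ, E) x) (x : G) : ℝ :=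
  ∑ i, g.inner x (curvature D (e i) Y Z x) (e i x)

/-- The Lie derivative `(L_X g)(Y,Z) = X (g(Y,Z)) - g([X,Y],Z) - g(Y,[X,Z])` at the point `x`. -/
def lieDerivMetric (g : SmoothMetric E G) (X Y Z : Π x : G, TangentSpace 𝓘(ℝ, E) x) (x : G) : ℝ :=
  mvfderiv 𝓘(ℝ, E) (fun y ↦ g.inner y (Y y) (Z y)) x (X x)
    - g.inner x (VectorField.mlieBracket 𝓘(ℝ, E) X Y x) (Z x)
    - g.inner x (Y x) (VectorField.mlieBracket 𝓘(ℝ, E) X Z x)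

/-- The left-invariant metric `g` is a Ricci soliton: `Ric + (1/2) L_X g = c g` for some smooth
vector field `X` on `G` (not assumed to be invariant) and some real number `c`. Both sides are
tensors, so the identity is tested at every point `x` on the left-invariant vector fields, whose
values exhaust the tangent space at `x`; the Ricci tensor is computed from the Levi-Civita
connection in a left-invariant frame which is orthonormal at the identity, hence everywhere. -/
def IsRicciSoliton (g : SmoothMetric E G) : Prop :=
  ∃ D : AffineConnection E G, IsLeviCivita g D ∧
  ∃ e : Module.Basis (Fin (Module.finrank ℝ E)) ℝ (GroupLieAlgebra 𝓘(ℝ, E) G),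
    (∀ i j, g.inner 1 (e i) (e j) = if i = j then 1 else 0) ∧
  ∃ (X : Π x : G, TangentSpace 𝓘(ℝ, E) x) (c : ℝ),
    ContMDiff 𝓘(ℝ, E) 𝓘(ℝ, E).tangent ∞
      (fun x ↦ (⟨x, X x⟩ : TangentBundle 𝓘(ℝ, E) G)) ∧
    ∀ (u v : GroupLieAlgebra 𝓘(ℝ, E) G) (x : G),
      ricci g D (fun i ↦ mulInvariantVectorField (e i))
          (mulInvariantVectorField u) (mulInvariantVectorField v) x
        + (1 / 2 : ℝ) *
          lieDerivMetric g X (mulInvariantVectorField u) (mulInvariantVectorField v) x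
      = c * g.inner x (mulInvariantVectorField u x) (mulInvariantVectorField v x)

variable (E G) in
/-- `G` admits a left-invariant Ricci soliton metric. -/
def AdmitsRicciSoliton : Prop :=
  ∃ g : SmoothMetric E G, IsLeftInvariant g ∧ IsRicciSoliton g

end RicciSoliton

/-! ### The symmetric space `GL(n)/O(n)` -/

section SymmetricSpace

/-- `O(n)` as a subgroup of `GL(n)`. -/
def orthogonalSubgroup (n : ℕ) : Subgroup (GL (Fin n) ℝ) where
  carrier := {A | (A : Matrix (Fin n) (Fin n) ℝ) ∈ Matrix.orthogonalGroup (Fin n) ℝ}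
  mul_mem' {A B} hA hB := by
    simpa using (Matrix.orthogonalGroup (Fin n) ℝ).mul_mem hA hB
  one_mem' := by simp [one_mem]
  inv_mem' {A} hA := by
    have h : ((A⁻¹ : GL (Fin n) ℝ) : Matrix (Fin n) (Fin n) ℝ)
        = star (A : Matrix (Fin n) (Fin n) ℝ) :=
      Units.inv_eq_of_mul_eq_one_right (Matrix.mem_orthogonalGroup_iff _ _ |>.1 hA)
    simp only [Set.mem_ofPred_eq, h]
    exact Unitary.star_mem hA

/-- The symmetric space `GL(n)/O(n)`, on which `GL(n)` acts by left multiplication. The coset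
`A O(n)` corresponds to the inner product `⟨A⁻¹ v, A⁻¹ w⟩` on `ℝⁿ`. -/
abbrev SymSpace (n : ℕ) : Type := GL (Fin n) ℝ ⧸ orthogonalSubgroup n

/-- The identification `A O(n) ↦ A Aᵀ` of `GL(n)/O(n)` with the positive definite matrices. -/
def SymSpace.toMatrix {n : ℕ} (p : SymSpace n) : Matrix (Fin n) (Fin n) ℝ :=
  Quotient.liftOn' p
    (fun A ↦ (A : Matrix (Fin n) (Fin n) ℝ) * (A : Matrix (Fin n) (Fin n) ℝ)ᵀ) (by
      intro A B h
      rw [QuotientGroup.leftRel_apply] at h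
      obtain ⟨C, rfl⟩ : ∃ C, B = A * C := ⟨A⁻¹ * B, by simp⟩
      rw [inv_mul_cancel_left] at h
      have h' : (C : Matrix (Fin n) (Fin n) ℝ) * (C : Matrix (Fin n) (Fin n) ℝ)ᵀ = 1 := by
        simpa [Matrix.star_eq_conjTranspose] using (Matrix.mem_orthogonalGroup_iff _ _).1 h
      simp only [Units.val_mul, Matrix.transpose_mul]
      rw [Matrix.mul_assoc, ← Matrix.mul_assoc (C : Matrix (Fin n) (Fin n) ℝ), h',
        Matrix.one_mul])

/-- The Riemannian distance of the symmetric space `GL(n)/O(n)`. On positive definite matrices the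
symmetric metric is `⟨U, V⟩_P = tr (P⁻¹ U P⁻¹ V)`, and the distance from `P` to `Q` is
`(∑ (log r)²)^(1/2)`, where `r` runs over the eigenvalues of `P⁻¹ Q` with multiplicity. -/
def SymSpace.rdist {n : ℕ} (p q : SymSpace n) : ℝ :=
  Real.sqrt (((p.toMatrix⁻¹ * q.toMatrix).charpoly.roots.map fun r ↦ Real.log r ^ 2).sum)

/-- Two subsets of `GL(n)/O(n)` are congruent if an isometry `φ ∈ GL(n)` of the symmetric space
sends one to the other. -/
def SymSpace.IsCongruent {n : ℕ} (S T : Set (SymSpace n)) : Prop :=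
  ∃ φ : GL (Fin n) ℝ,
    (∀ p q : SymSpace n, SymSpace.rdist (φ • p) (φ • q) = SymSpace.rdist p q) ∧ φ • S = T

/-- The group `ℝ^{>0}` of positive multiples of the identity. -/
def posScalars (n : ℕ) : Subgroup (GL (Fin n) ℝ) where
  carrier := {A | ∃ t : ℝ, 0 < t ∧ (A : Matrix (Fin n) (Fin n) ℝ) = t • 1}
  mul_mem' {A B} := by
    rintro ⟨s, hs, hA⟩ ⟨t, ht, hB⟩
    exact ⟨s * t, mul_pos hs ht, by simp [hA, hB, smul_smul, mul_comm]⟩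
  one_mem' := ⟨1, one_pos, by simp⟩
  inv_mem' {A} := by
    rintro ⟨t, ht, hA⟩
    refine ⟨t⁻¹, inv_pos.2 ht, Units.inv_eq_of_mul_eq_one_right ?_⟩
    rw [hA]
    simp [smul_smul, ht.ne']

variable {L : Type*} [LieRing L] [LieAlgebra ℝ L] {n : ℕ}

/-- `Aut(L)`, as a subgroup of `GL(n)` by means of the basis `b` of `L`. -/
def autGL (b : Module.Basis (Fin n) ℝ L) : Subgroup (GL (Fin n) ℝ) where
  carrier := {A | ∀ x y : L, Matrix.toLin b b A ⁅x, y⁆ = ⁅Matrix.toLin b b A x, Matrix.toLin b b A y⁆}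
  mul_mem' {A B} hA hB x y := by
    simp only [Set.mem_ofPred_eq] at hA hB
    simp [Matrix.toLin_mul b b b, hA, hB]
  one_mem' x y := by simp
  inv_mem' {A} hA x y := by
    simp only [Set.mem_ofPred_eq] at hA
    have h1 : ∀ z, Matrix.toLin b b A (Matrix.toLin b b (A⁻¹ : GL (Fin n) ℝ) z) = z := fun z ↦ by
      rw [← Matrix.toLin_mul_apply, ← Units.val_mul, mul_inv_cancel]; simp
    have h2 : ∀ z, Matrix.toLin b b (A⁻¹ : GL (Fin n) ℝ) (Matrix.toLin b b A z) = z := fun z ↦ by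
      rw [← Matrix.toLin_mul_apply, ← Units.val_mul, inv_mul_cancel]; simp
    conv_lhs => rw [← h1 x, ← h1 y, ← hA, h2]

/-- The identity component `Aut(L)_0`, as a subgroup of `GL(n)`. -/
def autGLZero (b : Module.Basis (Fin n) ℝ L) : Subgroup (GL (Fin n) ℝ) :=
  (Subgroup.connectedComponentOfOne (autGL b)).map (autGL b).subtype

/-- The group `ℝ^{>0} × Aut(L)_0`, as a subgroup of `GL(n)`; the positive scalars are central, so
this is the set of all products `t φ`. -/
def scaledAutZero (b : Module.Basis (Fin n) ℝ L) : Subgroup (GL (Fin n) ℝ) :=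
  posScalars n ⊔ autGLZero b

variable (L) in
/-- `L` is a 2-step nilpotent Lie algebra of type `(p, q)`: the commutator ideal `[L, L]` is central
of dimension `p ≥ 1`, and its complements have dimension `q`. -/
def IsTwoStepOfType (p q : ℕ) : Prop :=
  1 ≤ p ∧ LieModule.lowerCentralSeries ℝ L L 2 = ⊥ ∧
    Module.finrank ℝ (LieModule.lowerCentralSeries ℝ L L 1) = p ∧ Module.finrank ℝ L = p + q

end SymmetricSpace

end

/-! The example is a bracket `[v, w] = ∑ l, ⟨v, J l w⟩ z l` on `ℝ⁵ ⊕ ℝ⁴`, where the four skew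
integer matrices `jMat` satisfy two independent requirements.

Soliton: the `J l` are orthogonal of equal length and the sum of their squares is scalar. The Ricci
operator of the standard inner product is therefore scalar on `ℝ⁵` and on `ℝ⁴` (`ricci_stdBasis`).
It differs from a multiple of the identity by a multiple of the grading derivation with weights 1
and 2. A derivation `D` with `Ric + D = c` gives a Ricci soliton on the group with the
Baker-Campbell-Hausdorff product, with the linear vector field `y ↦ D y`
(`isRicciSoliton_of_basis`).

Rigidity: modulo the grading and the maps from `ℝ⁵` to the center `Z = ℝ⁴`, there are no derivations
(`derivation_eq_zero`). A quantitative version shows that automorphisms near the identity act by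
some `t > 0` on the quotient by `Z` and by `t ^ 2` on `Z` (`eventually_isScalingOn`). These maps
form a path-connected group, which is thus the identity component (`autGLZero_eq_gradedGL`). With
the positive scalars it generates the group of all maps acting by arbitrary positive scalars on `Z`
and on the quotient (`scaledAutZero_eq_scalingGL`).

That group depends only on the subspace `Z`. It is not transitive, because it acts on `Z` by scalars
and `dim Z ≥ 2` (`not_isPretransitive_scalingGL`). It is normalized by the stabilizer of `Z` in
`GL(9)`, which is transitive on `GL(9)/O(9)`; hence the stabilizer permutes the orbits transitively,
and it acts by isometries (`isCongruent_orbit_scalingGL`). -/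

noncomputable section

/-! ### The simply connected group of a 2-step nilpotent bracket -/

/-- A continuous 2-step nilpotent Lie bracket on a normed space. -/
class TwoStepBracket (E : Type*) [NormedAddCommGroup E] [NormedSpace ℝ E] where
  /-- The bracket. -/
  br : E →L[ℝ] E →L[ℝ] E
  br_self : ∀ x, br x x = 0
  br_br : ∀ x y z, br x (br y z) = 0

namespace TwoStepBracket

lemma mlieBracket_apply {E : Type*} [NormedAddCommGroup E] [NormedSpace ℝ E]
    (V W : E → E) (x : E) :
    (VectorField.mlieBracket 𝓘(ℝ, E) (M := E) V W x : E) =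
      fderiv ℝ W x (V x) - fderiv ℝ V x (W x) := by
  have h := congrFun (VectorField.mlieBracketWithin_eq_lieBracketWithin (𝕜 := ℝ) (E := E)
    (V := V) (W := W) (s := Set.univ)) x
  have h' := congrFun (VectorField.mlieBracketWithin_univ (I := 𝓘(ℝ, E)) (M := E)
    (V := V) (W := W)) x
  rw [VectorField.lieBracketWithin_univ] at h
  exact h'.symm.trans h

section Group

variable {E : Type*} [NormedAddCommGroup E] [NormedSpace ℝ E] [TwoStepBracket E]

lemma br_swap (x y : E) : br x y = -br y x := by
  have h := br_self (x + y)
  simp only [map_add, add_apply, br_self, zero_add, add_zero] at h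
  exact eq_neg_of_add_eq_zero_right h

lemma br_br_left (x y z : E) : br (br x y) z = 0 := by
  rw [br_swap, br_br, neg_zero]

/-- The group structure `x * y = x + y + [x, y] / 2` given by the Baker-Campbell-Hausdorff
formula. -/
scoped instance bchGroup : Group E where
  mul x y := x + y + (1 / 2 : ℝ) • br x y
  one := 0
  inv x := -x
  mul_assoc x y z := by
    change x + y + (1 / 2 : ℝ) • br x y + z + (1 / 2 : ℝ) • br (x + y + (1 / 2 : ℝ) • br x y) z =
      x + (y + z + (1 / 2 : ℝ) • br y z) + (1 / 2 : ℝ) • br x (y + z + (1 / 2 : ℝ) • br y z)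
    simp only [map_add, map_smul, add_apply, smul_apply,
      br_br, br_br_left]
    module
  one_mul x := by
    change 0 + x + (1 / 2 : ℝ) • br 0 x = x
    simp
  mul_one x := by
    change x + 0 + (1 / 2 : ℝ) • br x 0 = x
    simp
  inv_mul_cancel x := by
    change -x + x + (1 / 2 : ℝ) • br (-x) x = 0
    simp [br_self]

lemma mul_def (x y : E) : x * y = x + y + (1 / 2 : ℝ) • br x y := rfl

lemma one_def : (1 : E) = 0 := rfl

/-- The map `x ↦ br x` is a homomorphism to an abelian group, since brackets act trivially, and its
kernel is central. -/
lemma isNilpotent : Group.IsNilpotent E := by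
  let f : E →* Multiplicative (E →L[ℝ] E) :=
    { toFun x := Multiplicative.ofAdd (br x)
      map_one' := by simp [one_def]
      map_mul' x y := by
        rw [← ofAdd_add]
        congr 1
        ext z
        simp [mul_def, br_br_left] }
  refine Subgroup.isNilpotent_of_ker_le_center f fun x hx ↦ ?_
  have hx : br x = 0 := hx
  refine Subgroup.mem_center_iff.2 fun y ↦ ?_
  rw [mul_def, mul_def, br_swap y x, hx]
  simp [add_comm]

instance lieGroup : LieGroup 𝓘(ℝ, E) ∞ E where
  contMDiff_mul := by
    rw [← modelWithCornersSelf_prod, chartedSpaceSelf_prod, contMDiff_iff_contDiff]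
    change ContDiff ℝ ∞ fun p : E × E ↦ p.1 + p.2 + (1 / 2 : ℝ) • br p.1 p.2
    fun_prop
  contMDiff_inv := by
    rw [contMDiff_iff_contDiff]
    change ContDiff ℝ ∞ fun x : E ↦ -x
    fun_prop

/-- The differential of the left translation by `x`, at any point. -/
def transl (x : E) : E →L[ℝ] E := .id ℝ E + (1 / 2 : ℝ) • br x

/-- The left-invariant parallelism: the inverse of `transl x`. -/
def untransl (x : E) : E →L[ℝ] E := .id ℝ E - (1 / 2 : ℝ) • br x

lemma transl_apply (x v : E) : transl x v = v + (1 / 2 : ℝ) • br x v := by simp [transl]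

lemma untransl_apply (x v : E) : untransl x v = v - (1 / 2 : ℝ) • br x v := by simp [untransl]

@[simp] lemma untransl_transl (x v : E) : untransl x (transl x v) = v := by
  simp [transl_apply, untransl_apply, br_br]

@[simp] lemma transl_untransl (x v : E) : transl x (untransl x v) = v := by
  simp [transl_apply, untransl_apply, br_br]

@[simp] lemma transl_br (x y z : E) : transl x (br y z) = br y z := by
  simp [transl_apply, br_br]

@[simp] lemma br_transl_left (x y z : E) : br (transl x y) z = br y z := by
  simp [transl_apply, br_br_left]

/-- Left invariance of the parallelism `untransl`; the left invariance of the metric is a direct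
consequence. -/
lemma untransl_mul_transl (a x v : E) : untransl (a * x) (transl a v) = untransl x v := by
  simp only [transl_apply, untransl_apply, mul_def, map_add, map_smul,
    add_apply, smul_apply, br_br, br_br_left]
  module

lemma hasFDerivAt_mul_left (a x : E) : HasFDerivAt (fun y : E ↦ a * y) (transl a) x := by
  change HasFDerivAt (fun y : E ↦ a + y + (1 / 2 : ℝ) • br a y) (transl a) x
  exact ((hasFDerivAt_id x).const_add a).add ((br a).hasFDerivAt.const_smul (1 / 2 : ℝ))

lemma mfderiv_mul_left (a x : E) :
    (mfderiv 𝓘(ℝ, E) 𝓘(ℝ, E) (fun y : E ↦ a * y) x : E →L[ℝ] E) = transl a := by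
  rw [mfderiv_eq_fderiv]
  exact (hasFDerivAt_mul_left a x).fderiv

lemma mulInvariantVectorField_eq (v : E) :
    (mulInvariantVectorField (I := 𝓘(ℝ, E)) (G := E) v : E → E) = fun x : E ↦ transl x v := by
  ext1 x
  exact congrArg (fun f : E →L[ℝ] E ↦ f v) (mfderiv_mul_left x 1)

lemma hasFDerivAt_transl {f : E → E} {f' : E →L[ℝ] E} {x : E} (hf : HasFDerivAt f f' x) :
    HasFDerivAt (fun y ↦ transl y (f y))
      ((transl x).comp f' + (1 / 2 : ℝ) • br.flip (f x)) x := by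
  have h := hf.add ((br.hasFDerivAt (x := x)).clm_apply hf |>.const_smul (1 / 2 : ℝ))
  refine (h.congr_fderiv ?_).congr_of_eventuallyEq (.of_forall fun y ↦ transl_apply y (f y))
  ext v
  simp [transl_apply]
  module

lemma fderiv_transl_const (w x : E) :
    fderiv ℝ (fun x : E ↦ transl x w) x = (1 / 2 : ℝ) • br.flip w := by
  rw [(hasFDerivAt_transl (hasFDerivAt_const w x)).fderiv]
  simp

lemma mlieBracket_transl (u v x : E) :
    (VectorField.mlieBracket 𝓘(ℝ, E) (M := E) (fun y : E ↦ transl y u) (fun y : E ↦ transl y v) x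
      : E) = br u v := by
  have h : fderiv ℝ (fun y : E ↦ transl y v) x (transl x u) -
      fderiv ℝ (fun y : E ↦ transl y u) x (transl x v) = br u v := by
    rw [fderiv_transl_const, fderiv_transl_const]
    simp only [smul_apply, ContinuousLinearMap.flip_apply, br_transl_left]
    rw [br_swap v u]
    module
  exact (mlieBracket_apply _ _ x).trans h

lemma mlieBracket_mulInvariantVectorField (u v x : E) :
    (VectorField.mlieBracket 𝓘(ℝ, E) (mulInvariantVectorField (I := 𝓘(ℝ, E)) (G := E) u)
      (mulInvariantVectorField (I := 𝓘(ℝ, E)) (G := E) v) x : E) = br u v := by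
  have h := mlieBracket_transl u v x
  rw [← mulInvariantVectorField_eq, ← mulInvariantVectorField_eq] at h
  exact h

lemma bracket_eq (u v : E) :
    (Bracket.bracket (L := GroupLieAlgebra 𝓘(ℝ, E) E) (M := GroupLieAlgebra 𝓘(ℝ, E) E) u v : E) =
      br u v :=
  mlieBracket_mulInvariantVectorField u v 1

end Group

end TwoStepBracket

/-! ### The left-invariant metric defined by an inner product -/

namespace TwoStepBracket

/-- The cotangent bundle of a vector space is trivialized by the identity, so smoothness of the
metric as a section reduces to `contDiff_metricForm`. -/
lemma linearMapAt_cotangent_model {E : Type*} [NormedAddCommGroup E] [NormedSpace ℝ E] (x y : E)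
    (φ : TangentSpace 𝓘(ℝ, E) y →L[ℝ] ℝ) (w : E) :
    ((trivializationAt (E →L[ℝ] ℝ) (fun x : E ↦ TangentSpace 𝓘(ℝ, E) x →L[ℝ] ℝ) x).linearMapAt ℝ y φ
      : E →L[ℝ] ℝ) w = φ w := by
  rw [Bundle.Trivialization.linearMapAt_apply]
  simp only [hom_trivializationAt_apply, ContinuousLinearMap.inCoordinates]
  rw [if_pos (by exact ⟨Set.mem_univ y, Set.mem_univ y⟩)]
  simp
  rfl

section Metric

variable {E : Type*} [NormedAddCommGroup E] [InnerProductSpace ℝ E] [TwoStepBracket E]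

/-- The left-invariant metric which agrees with the inner product of `E` at the identity. -/
def metricForm (x : E) : E →L[ℝ] E →L[ℝ] ℝ := (innerSL ℝ).bilinearComp (untransl x) (untransl x)

lemma metricForm_apply (x v w : E) :
    metricForm x v w = inner ℝ (untransl x v) (untransl x w) := by
  simp [metricForm]

lemma contDiff_metricForm : ContDiff ℝ ∞ (metricForm : E → E →L[ℝ] E →L[ℝ] ℝ) := by
  have h : ContDiff ℝ ∞ (untransl : E → E →L[ℝ] E) := by
    unfold untransl
    fun_prop
  have h2 : ContDiff ℝ ∞ fun x : E ↦ (ContinuousLinearMap.compL ℝ E E ℝ).flip (untransl x) :=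
    (ContinuousLinearMap.contDiff _).comp h
  have h3 := h2.clm_comp ((contDiff_const (c := innerSL ℝ (E := E))).clm_comp h)
  convert h3 using 1
  ext x v w
  simp [metricForm, innerSL_apply_apply]
  rfl

lemma isVonNBounded_metricForm (x : E) :
    Bornology.IsVonNBounded ℝ {v : E | metricForm x v v < 1} := by
  have h : {v : E | metricForm x v v < 1} ⊆ transl x '' Metric.ball 0 1 := fun v hv ↦ by
    refine ⟨untransl x v, ?_, transl_untransl x v⟩
    have hv : metricForm x v v < 1 := hv
    rw [metricForm_apply, real_inner_self_eq_norm_sq] at hv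
    rw [mem_ball_zero_iff]
    nlinarith [norm_nonneg (untransl x v)]
  exact ((NormedSpace.isVonNBounded_ball ℝ E 1).image (transl x)).subset h

variable (E) in
/-- The left-invariant metric on `E`, with the group structure defined by the bracket. -/
def invMetric : SmoothMetric E E where
  inner x := metricForm (E := E) x
  symm x v w := by
    have h (v w : E) : metricForm x v w = metricForm x w v := by
      simp only [metricForm_apply, real_inner_comm]
    exact h v w
  pos x v hv := by
    have h (v : E) (hv : v ≠ 0) : 0 < metricForm x v v := by
      rw [metricForm_apply]
      refine real_inner_self_pos.2 fun h ↦ hv ?_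
      rw [← transl_untransl x v, h, map_zero]
    exact h v hv
  isVonNBounded x := isVonNBounded_metricForm (E := E) x
  contMDiff := by
    intro x
    refine (Bundle.contMDiffAt_section _).2 ?_
    convert! (contDiff_metricForm (E := E)).contMDiff.contMDiffAt (x := x)
    ext v w
    simp only [hom_trivializationAt_apply, ContinuousLinearMap.inCoordinates]
    simp
    exact linearMapAt_cotangent_model x _ _ w

end Metric

end TwoStepBracket

/-! ### Left invariance and Lie derivatives along linear fields -/

namespace TwoStepBracket

lemma differentiableAt_of_mdifferentiableAt_section {E : Type*} [NormedAddCommGroup E]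
    [NormedSpace ℝ E] {V : E → E} {x : E}
    (h : MDifferentiableAt 𝓘(ℝ, E) 𝓘(ℝ, E).tangent
      (fun y : E ↦ (⟨y, V y⟩ : TangentBundle 𝓘(ℝ, E) E)) x) : DifferentiableAt ℝ V x := by
  have h2 := (mdifferentiableAt_section (F := E) (E := (TangentSpace 𝓘(ℝ, E) : E → Type _)) 𝓘(ℝ, E) V).1 h
  rw [mdifferentiableAt_iff_differentiableAt] at h2
  convert! h2 using 2
  simp

section

variable {E : Type*} [NormedAddCommGroup E] [InnerProductSpace ℝ E] [TwoStepBracket E]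

lemma _root_.DifferentiableAt.untransl {Y : E → E} {x : E} (hY : DifferentiableAt ℝ Y x) :
    DifferentiableAt ℝ (fun y ↦ TwoStepBracket.untransl y (Y y)) x := by
  simp only [untransl_apply]
  fun_prop

lemma isLeftInvariant : IsLeftInvariant (invMetric E) := by
  intro a x v w
  have h (v w : E) :
      metricForm (a * x) (transl a v) (transl a w) = metricForm x v w := by
    simp only [metricForm_apply, untransl_mul_transl]
  have h' := h v w
  rw [← mfderiv_mul_left a x] at h'
  exact h'

/-- The flow of `D` consists of automorphisms, so its bracket with the left-invariant field of `w`
is minus that of `D w`. The product of two left-invariant fields is constant, so only the bracket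
terms contribute. -/
lemma lieDerivMetric_linear (D : E →L[ℝ] E) (hD : ∀ x y, D (br x y) = br (D x) y + br x (D y))
    (u v x : E) :
    lieDerivMetric (invMetric E) (fun y : E ↦ D y) (fun y : E ↦ transl y u)
      (fun y : E ↦ transl y v) x = inner ℝ (D u) v + inner ℝ u (D v) := by
  have hb (w : E) : (VectorField.mlieBracket 𝓘(ℝ, E) (M := E) (fun y : E ↦ D y)
      (fun y : E ↦ transl y w) x : E) = -transl x (D w) := by
    have h : fderiv ℝ (fun y : E ↦ transl y w) x (D x) - fderiv ℝ (fun y ↦ D y) x (transl x w)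
        = -transl x (D w) := by
      rw [fderiv_transl_const, D.fderiv]
      simp [transl_apply, hD]
      module
    exact (mlieBracket_apply _ _ x).trans h
  have h : fderiv ℝ (fun y : E ↦ metricForm y (transl y u) (transl y v)) x (D x)
      - metricForm x (-transl x (D u)) (transl x v) - metricForm x (transl x u) (-transl x (D v))
      = inner ℝ (D u) v + inner ℝ u (D v) := by
    simp [metricForm_apply]
  rw [← hb u, ← hb v, ← mfderiv_eq_fderiv] at h
  exact h

end

/-! ### The Levi-Civita connection, its curvature, and algebraic solitons -/

section Connection

variable {E : Type*} [NormedAddCommGroup E] [InnerProductSpace ℝ E] [FiniteDimensional ℝ E]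
  [TwoStepBracket E]

/-- The Levi-Civita product `∇ x y` of left-invariant vector fields. -/
def lcProd : E →ₗ[ℝ] E →ₗ[ℝ] E :=
  LinearMap.mk₂ ℝ
    (fun x y ↦ (1 / 2 : ℝ) • (br x y - (ContinuousLinearMap.adjoint (br x)) y
      - (ContinuousLinearMap.adjoint (br y)) x))
    (fun x x' y ↦ by simp only [map_add, add_apply]; module)
    (fun c x y ↦ by
      simp only [map_smul, smul_apply]; module)
    (fun x y y' ↦ by simp only [map_add, add_apply]; module)
    (fun c x y ↦ by
      simp only [map_smul, smul_apply]; module)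

lemma lcProd_apply (x y : E) : lcProd x y =
    (1 / 2 : ℝ) • (br x y - (ContinuousLinearMap.adjoint (br x)) y
      - (ContinuousLinearMap.adjoint (br y)) x) := rfl

/-- The Koszul formula: on left-invariant fields the derivative terms vanish. -/
lemma inner_lcProd (x y z : E) : inner ℝ (lcProd x y) z =
    (1 / 2 : ℝ) * (inner ℝ (br x y) z - inner ℝ y (br x z) - inner ℝ x (br y z)) := by
  rw [lcProd_apply, real_inner_smul_left, inner_sub_left, inner_sub_left,
    ContinuousLinearMap.adjoint_inner_left, ContinuousLinearMap.adjoint_inner_left]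

lemma lcProd_sub_swap (x y : E) : lcProd x y - lcProd y x = br x y := by
  rw [lcProd_apply, lcProd_apply, br_swap y x]
  module

lemma inner_lcProd_add (x y z : E) : inner ℝ (lcProd x y) z + inner ℝ y (lcProd x z) = 0 := by
  have h : inner ℝ x (br z y) = -inner ℝ x (br y z) := by rw [br_swap z y, inner_neg_right]
  rw [real_inner_comm (lcProd x z) y, inner_lcProd, inner_lcProd, h,
    real_inner_comm (br x y) z, real_inner_comm (br x z) y]
  ring

/-- The Levi-Civita connection of the left-invariant metric, in the left-invariant parallelism. -/
def lcFun (Y : E → E) (x : E) : E →L[ℝ] E :=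
  (transl x).comp (fderiv ℝ (fun y ↦ untransl y (Y y)) x +
    (LinearMap.toContinuousLinearMap (lcProd.flip (untransl x (Y x)))).comp (untransl x))

lemma lcFun_apply (Y : E → E) (x v : E) : lcFun Y x v =
    transl x (fderiv ℝ (fun y ↦ untransl y (Y y)) x v + lcProd (untransl x v) (untransl x (Y x))) := by
  simp [lcFun]

lemma lcFun_transl (v x w : E) :
    lcFun (fun y ↦ transl y v) x (transl x w) = transl x (lcProd w v) := by
  simp [lcFun_apply]

lemma lcFun_add {Y Z : E → E} {x : E} (hY : DifferentiableAt ℝ Y x) (hZ : DifferentiableAt ℝ Z x) :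
    lcFun (Y + Z) x = lcFun Y x + lcFun Z x := by
  ext v
  simp only [lcFun_apply, add_apply, fderiv_fun_add hY.untransl hZ.untransl, Pi.add_apply,
    map_add]
  module

lemma lcFun_smul {f : E → ℝ} {Y : E → E} {x : E} (hY : DifferentiableAt ℝ Y x)
    (hf : DifferentiableAt ℝ f x) :
    lcFun (f • Y) x = f x • lcFun Y x + (fderiv ℝ f x).smulRight (Y x) := by
  ext v
  simp only [lcFun_apply, add_apply, fderiv_fun_smul hf hY.untransl, Pi.smul_apply', map_add,
    map_smul, smul_apply, ContinuousLinearMap.smulRight_apply, transl_untransl]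
  module

variable (E) in
/-- The Levi-Civita connection of the left-invariant metric. -/
def lcConnection : AffineConnection E E where
  toFun Y x := lcFun (E := E) Y x
  isCovariantDerivativeOnUniv :=
    { add := fun {Y Z x} hY hZ _ ↦ lcFun_add (differentiableAt_of_mdifferentiableAt_section hY)
        (differentiableAt_of_mdifferentiableAt_section hZ)
      leibniz := fun {Y f x} hY hf _ ↦ by
        have h := lcFun_smul (differentiableAt_of_mdifferentiableAt_section hY)
          (mdifferentiableAt_iff_differentiableAt.1 hf)
        rw [← mfderiv_eq_fderiv] at h
        exact h }

lemma lcFun_torsion {X Y : E → E} {x : E} (hX : DifferentiableAt ℝ X x)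
    (hY : DifferentiableAt ℝ Y x) :
    lcFun Y x (X x) - lcFun X x (Y x) = fderiv ℝ Y x (X x) - fderiv ℝ X x (Y x) := by
  -- The derivative in the linear coordinates differs from the one in the left-invariant parallelism
  -- by half a bracket. The two halves add up to the antisymmetric part of `lcProd`.
  have key {Z : E → E} (hZ : DifferentiableAt ℝ Z x) (v : E) : fderiv ℝ Z x v =
      transl x (fderiv ℝ (fun y ↦ untransl y (Z y)) x v)
        + (1 / 2 : ℝ) • br v (untransl x (Z x)) := by
    have h := (hasFDerivAt_transl hZ.untransl.hasFDerivAt).fderiv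
    simp only [transl_untransl] at h
    rw [h]
    simp
  have h1 : br (X x) (untransl x (Y x)) = br (untransl x (X x)) (untransl x (Y x)) := by
    conv_lhs => rw [← transl_untransl x (X x), br_transl_left]
  have h2 : br (Y x) (untransl x (X x)) = -br (untransl x (X x)) (untransl x (Y x)) := by
    conv_lhs => rw [← transl_untransl x (Y x), br_transl_left, br_swap]
  have h3 : transl x (lcProd (untransl x (X x)) (untransl x (Y x)))
      - transl x (lcProd (untransl x (Y x)) (untransl x (X x)))
      = br (untransl x (X x)) (untransl x (Y x)) := by
    rw [← map_sub, lcProd_sub_swap, transl_br]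
  rw [key hX, key hY, h1, h2, lcFun_apply, lcFun_apply, map_add, map_add, ← h3]
  module

/-- In the left-invariant parallelism the metric is a constant inner product, and `lcProd x` is
skew-adjoint for it. -/
lemma fderiv_metricForm {Y Z : E → E} {x : E} (hY : DifferentiableAt ℝ Y x)
    (hZ : DifferentiableAt ℝ Z x) (v : E) :
    fderiv ℝ (fun y ↦ metricForm y (Y y) (Z y)) x v =
      metricForm x (lcFun Y x v) (Z x) + metricForm x (Y x) (lcFun Z x v) := by
  simp only [metricForm_apply]
  rw [fderiv_inner_apply ℝ hY.untransl hZ.untransl]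
  simp only [lcFun_apply, untransl_transl, inner_add_left, inner_add_right]
  linear_combination -inner_lcProd_add (untransl x v) (untransl x (Y x)) (untransl x (Z x))

lemma isLeviCivita : IsLeviCivita (invMetric E) (lcConnection E) := by
  constructor
  · refine (lcConnection E).torsion_eq_zero_iff.2 fun {X Y x} hX hY ↦ ?_
    exact (lcFun_torsion (differentiableAt_of_mdifferentiableAt_section hX)
      (differentiableAt_of_mdifferentiableAt_section hY)).trans (mlieBracket_apply X Y x).symm
  · intro Y Z x hY hZ v
    have h := fderiv_metricForm (differentiableAt_of_mdifferentiableAt_section hY)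
      (differentiableAt_of_mdifferentiableAt_section hZ) v
    rw [← mfderiv_eq_fderiv] at h
    exact h

/-- The curvature of the left-invariant metric at the identity. -/
def lcCurv (u v w : E) : E := lcProd u (lcProd v w) - lcProd v (lcProd u w) - lcProd (br u v) w

lemma curvature_lcConnection (u v w x : E) :
    (curvature (lcConnection E) (fun y : E ↦ transl y u) (fun y : E ↦ transl y v)
      (fun y : E ↦ transl y w) x : E) = transl x (lcCurv u v w) := by
  have h : lcFun (fun y ↦ lcFun (fun z ↦ transl z w) y (transl y v)) x (transl x u)
      - lcFun (fun y ↦ lcFun (fun z ↦ transl z w) y (transl y u)) x (transl x v)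
      - lcFun (fun z ↦ transl z w) x (transl x (br u v)) = transl x (lcCurv u v w) := by
    simp only [lcFun_transl, lcCurv, map_sub]
  rw [transl_br, ← mlieBracket_transl u v x] at h
  exact h

lemma ricci_invMetric {ι : Type*} [Fintype ι] (e : ι → E) (u v x : E) :
    ricci (invMetric E) (lcConnection E) (fun i (y : E) ↦ transl y (e i)) (fun y : E ↦ transl y u)
      (fun y : E ↦ transl y v) x = ∑ i, inner ℝ (lcCurv (e i) u v) (e i) := by
  refine Finset.sum_congr rfl fun i _ ↦ ?_
  have h : metricForm x (transl x (lcCurv (e i) u v)) (transl x (e i)) =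
      inner ℝ (lcCurv (e i) u v) (e i) := by
    simp [metricForm_apply]
  rw [← curvature_lcConnection (e i) u v x] at h
  exact h

/-- The algebraic soliton condition `Ric + D = c` at the identity, for a derivation `D`, makes the
left-invariant metric a Ricci soliton. -/
theorem isRicciSoliton_invMetric (e : OrthonormalBasis (Fin (Module.finrank ℝ E)) ℝ E)
    (D : E →L[ℝ] E) (hD : ∀ x y, D (br x y) = br (D x) y + br x (D y)) (c : ℝ)
    (h : ∀ u v, ∑ i, inner ℝ (lcCurv (e i) u v) (e i)
      + (1 / 2 : ℝ) * (inner ℝ (D u) v + inner ℝ u (D v)) = c * inner ℝ u v) :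
    IsRicciSoliton (invMetric E) := by
  refine ⟨lcConnection E, isLeviCivita, e.toBasis, fun i j ↦ ?_, fun y : E ↦ D y, c, ?_,
    fun u v x ↦ ?_⟩
  · have h : metricForm (1 : E) (e i) (e j) = if i = j then 1 else 0 := by
      rw [metricForm_apply, ← orthonormal_iff_ite.1 e.orthonormal i j]
      simp [untransl_apply, one_def]
    rw [← e.coe_toBasis] at h
    exact h
  · have h := (contMDiff_vectorSpace_iff_contDiff (𝕜 := ℝ) (E := E) (n := ∞)
      (V := fun y : E ↦ D y)).2 D.contDiff
    exact h
  · have key (u v : E) (F : Fin (Module.finrank ℝ E) → E → E) (U V : E → E)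
        (hF : F = fun i y ↦ transl y (e i)) (hU : U = fun y ↦ transl y u)
        (hV : V = fun y ↦ transl y v) :
        ricci (invMetric E) (lcConnection E) F U V x + (1 / 2 : ℝ) *
          lieDerivMetric (invMetric E) (fun y : E ↦ D y) U V x = c * metricForm x (U x) (V x) := by
      subst hF hU hV
      rw [ricci_invMetric, lieDerivMetric_linear D hD, h, metricForm_apply, untransl_transl,
        untransl_transl]
    refine key u v _ _ _ (funext fun i ↦ ?_) (mulInvariantVectorField_eq (E := E) u)
      (mulInvariantVectorField_eq (E := E) v)
    rw [← e.coe_toBasis]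
    exact mulInvariantVectorField_eq (E := E) (e.toBasis i)

end Connection

end TwoStepBracket

/-! ### The soliton condition in an orthonormal basis -/

namespace TwoStepBracket

section

variable {E : Type*} [NormedAddCommGroup E] [InnerProductSpace ℝ E] [FiniteDimensional ℝ E]
  [TwoStepBracket E]

/-- It suffices to check the algebraic soliton condition on an orthonormal basis. -/
theorem isRicciSoliton_of_basis {ι : Type*} [Fintype ι] (e : OrthonormalBasis ι ℝ E)
    (D : E →L[ℝ] E) (hD : ∀ x y, D (br x y) = br (D x) y + br x (D y)) (c : ℝ)
    (h : ∀ j k, ∑ i, inner ℝ (lcCurv (e i) (e j) (e k)) (e i)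
      + (1 / 2 : ℝ) * (inner ℝ (D (e j)) (e k) + inner ℝ (e j) (D (e k)))
        = c * inner ℝ (e j) (e k)) :
    IsRicciSoliton (invMetric E) := by
  let σ : ι ≃ Fin (Module.finrank ℝ E) :=
    Fintype.equivFinOfCardEq (Module.finrank_eq_card_basis e.toBasis).symm
  refine isRicciSoliton_invMetric (e.reindex σ) D hD c fun u v ↦ ?_
  have hσ : ∑ i, inner ℝ (lcCurv (e.reindex σ i) u v) (e.reindex σ i) =
      ∑ i, inner ℝ (lcCurv (e i) u v) (e i) := by
    rw [← σ.sum_comp]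
    simp
  rw [hσ]
  let F : E →ₗ[ℝ] E →ₗ[ℝ] ℝ := LinearMap.mk₂ ℝ
    (fun u v ↦ ∑ i, inner ℝ (lcCurv (e i) u v) (e i)
      + (1 / 2 : ℝ) * (inner ℝ (D u) v + inner ℝ u (D v)))
    (fun u u' v ↦ by
      simp only [lcCurv, map_add, LinearMap.add_apply, inner_add_left, inner_sub_left,
        Finset.sum_add_distrib, Finset.sum_sub_distrib]
      ring)
    (fun a u v ↦ by
      simp only [lcCurv, map_smul, LinearMap.smul_apply, real_inner_smul_left, inner_sub_left,
        Finset.sum_sub_distrib, ← Finset.mul_sum, smul_eq_mul]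
      ring)
    (fun u v v' ↦ by
      simp only [lcCurv, map_add, inner_add_left, inner_add_right, inner_sub_left,
        Finset.sum_add_distrib, Finset.sum_sub_distrib]
      ring)
    (fun a u v ↦ by
      simp only [lcCurv, map_smul, real_inner_smul_left, real_inner_smul_right, inner_sub_left,
        Finset.sum_sub_distrib, ← Finset.mul_sum, smul_eq_mul]
      ring)
  have hF : F = c • innerₗ E := by
    refine LinearMap.ext_basis e.toBasis e.toBasis fun j k ↦ ?_
    simpa [F] using h j k
  exact congrArg (fun B : E →ₗ[ℝ] E →ₗ[ℝ] ℝ ↦ B u v) hF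

/-- The curvature in terms of the connection coefficients of an orthonormal basis. -/
lemma inner_lcProd_lcProd {ι : Type*} [Fintype ι] (e : OrthonormalBasis ι ℝ E) (a b c d : ι) :
    inner ℝ (lcProd (e a) (lcProd (e b) (e c))) (e d) =
      ∑ m, inner ℝ (lcProd (e b) (e c)) (e m) * inner ℝ (lcProd (e a) (e m)) (e d) := by
  conv_lhs => rw [← e.sum_repr' (lcProd (e b) (e c))]
  simp only [map_sum, map_smul, sum_inner, real_inner_smul_right, real_inner_comm]

lemma inner_lcProd_br {ι : Type*} [Fintype ι] (e : OrthonormalBasis ι ℝ E) (a b c d : ι) :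
    inner ℝ (lcProd (br (e a) (e b)) (e c)) (e d) =
      ∑ m, inner ℝ (br (e a) (e b)) (e m) * inner ℝ (lcProd (e m) (e c)) (e d) := by
  conv_lhs => rw [← e.sum_repr' (br (e a) (e b))]
  simp only [map_sum, map_smul, sum_inner, real_inner_smul_right, real_inner_comm,
    LinearMap.sum_apply, LinearMap.smul_apply]

end

end TwoStepBracket

open TwoStepBracket

/-! ### A rigid 2-step nilpotent Lie algebra of type `(4, 5)` -/

/-- The skew-symmetric matrices `J l`, which define the bracket `[v, w] = ∑ l, ⟨v, J l w⟩ z l` of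
`ℝ⁵ ⊕ ℝ⁴`. They are orthogonal and of the same length, and the sum of their squares is scalar. -/
def jMat : Fin 4 → Matrix (Fin 5) (Fin 5) ℤ := ![
  !![0, 0, 0, 0, 1; 0, 0, 0, 1, 0; 0, 0, 0, 1, 1; 0, -1, -1, 0, 1; -1, 0, -1, -1, 0],
  !![0, 0, 1, -1, 1; 0, 0, -1, -1, 0; -1, 1, 0, 0, 0; 1, 1, 0, 0, 0; -1, 0, 0, 0, 0],
  !![0, 1, 0, 0, 1; -1, 0, 0, 1, 0; 0, 0, 0, -1, -1; 0, -1, 1, 0, 0; -1, 0, 1, 0, 0],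
  !![0, 0, 1, 0, -1; 0, 0, -1, 1, -1; -1, 1, 0, 0, 0; 0, -1, 0, 0, 0; 1, 1, 0, 0, 0]]

/-- The structure constants of the Lie algebra in the basis `e 0, …, e 8` of `ℝ⁹`, of which
the last four vectors span the center. -/
def structConst (i j k : Fin 9) : ℤ :=
  if h : i.1 < 5 ∧ j.1 < 5 ∧ 5 ≤ k.1 then jMat ⟨k.1 - 5, by omega⟩ ⟨i.1, h.1⟩ ⟨j.1, h.2.1⟩ else 0

/-- The connection coefficients of the Lie algebra, multiplied by `2`. -/
def connCoeff (i j k : Fin 9) : ℤ :=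
  structConst i j k - structConst i k j - structConst j k i

lemma structConst_swap : ∀ i j k, structConst i j k = -structConst j i k := by decide +kernel

lemma structConst_eq_zero_of_le {i : Fin 9} (hi : 5 ≤ i.1) (j k : Fin 9) : structConst i j k = 0 := by
  simp [structConst, Nat.not_lt.2 hi]

lemma structConst_eq_zero_of_lt (i j : Fin 9) {k : Fin 9} (hk : k.1 < 5) : structConst i j k = 0 := by
  simp [structConst, Nat.not_le.2 hk]

/-- Four times the Ricci tensor, so that all terms are integers. It comes from `(1/2) ∑ (J l)² = -4`
on `ℝ⁵` and `-(1/4) tr (J l)² = 5/2` on the center. -/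
lemma structConst_ricci : ∀ j k, ∑ i, ((∑ m, connCoeff j k m * connCoeff i m i)
    - (∑ m, connCoeff i k m * connCoeff j m i) - ∑ m, 2 * structConst i j m * connCoeff m k i)
    = if j = k then (if j.1 < 5 then -16 else 10) else 0 := by
  decide +kernel

local notation "E₉" => EuclideanSpace ℝ (Fin 9)

/-- The bracket of the Lie algebra. -/
def rigidBr : E₉ →ₗ[ℝ] E₉ →ₗ[ℝ] E₉ :=
  LinearMap.mk₂ ℝ (fun x y ↦ WithLp.toLp 2 fun k ↦ ∑ i, ∑ j, structConst i j k * (x i * y j))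
    (fun x x' y ↦ by
      ext k
      simp [add_mul, mul_add, Finset.sum_add_distrib])
    (fun c x y ↦ by
      ext k
      simp only [PiLp.smul_apply, smul_eq_mul, Finset.mul_sum]
      refine Finset.sum_congr rfl fun i _ ↦ Finset.sum_congr rfl fun j _ ↦ by ring)
    (fun x y y' ↦ by
      ext k
      simp [mul_add, Finset.sum_add_distrib])
    (fun c x y ↦ by
      ext k
      simp only [PiLp.smul_apply, smul_eq_mul, Finset.mul_sum]
      refine Finset.sum_congr rfl fun i _ ↦ Finset.sum_congr rfl fun j _ ↦ by ring)

lemma rigidBr_apply (x y : E₉) (k : Fin 9) :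
    rigidBr x y k = ∑ i, ∑ j, structConst i j k * (x i * y j) := rfl

lemma rigidBr_swap (x y : E₉) : rigidBr x y = -rigidBr y x := by
  ext k
  rw [PiLp.neg_apply, rigidBr_apply, rigidBr_apply, Finset.sum_comm]
  simp only [← Finset.sum_neg_distrib]
  refine Finset.sum_congr rfl fun i _ ↦ Finset.sum_congr rfl fun j _ ↦ ?_
  rw [structConst_swap]
  push_cast
  ring

/-- The center of the Lie algebra, which is also its commutator ideal. -/
def rigidCenter : Submodule ℝ E₉ where
  carrier := {x | ∀ i : Fin 9, i.1 < 5 → x i = 0}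
  add_mem' hx hy i hi := by simp [hx i hi, hy i hi]
  zero_mem' i _ := rfl
  smul_mem' c x hx i hi := by simp [hx i hi]

lemma mem_rigidCenter {x : E₉} : x ∈ rigidCenter ↔ ∀ i : Fin 9, i.1 < 5 → x i = 0 := Iff.rfl

lemma rigidBr_mem (x y : E₉) : rigidBr x y ∈ rigidCenter := fun k hk ↦ by
  simp [rigidBr_apply, structConst_eq_zero_of_lt _ _ hk]

lemma rigidBr_eq_zero_of_mem {x : E₉} (hx : x ∈ rigidCenter) (y : E₉) : rigidBr x y = 0 := by
  ext k
  rw [rigidBr_apply]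
  refine Finset.sum_eq_zero fun i _ ↦ Finset.sum_eq_zero fun j _ ↦ ?_
  rcases lt_or_ge i.1 5 with hi | hi
  · rw [hx i hi]
    simp
  · simp [structConst_eq_zero_of_le hi]

instance rigidBracket : TwoStepBracket E₉ where
  br := rigidBr.toContinuousBilinearMap
  br_self x := by
    have h : rigidBr x x = -rigidBr x x := rigidBr_swap x x
    have h2 : (2 : ℝ) • rigidBr x x = 0 := by
      rw [two_smul]
      nth_rewrite 1 [h]
      exact neg_add_cancel _
    exact (smul_eq_zero.1 h2).resolve_left two_ne_zero
  br_br x y z := by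
    have h : rigidBr x (rigidBr y z) = 0 := by
      rw [rigidBr_swap, rigidBr_eq_zero_of_mem (rigidBr_mem y z), neg_zero]
    exact h

lemma br_eq_rigidBr (x y : E₉) : br x y = rigidBr x y := rfl

lemma rigidBr_basis (i j k : Fin 9) :
    rigidBr (EuclideanSpace.single i 1) (EuclideanSpace.single j 1) k = structConst i j k := by
  simp [rigidBr_apply]

/-- The standard orthonormal basis. -/
abbrev stdBasis : OrthonormalBasis (Fin 9) ℝ E₉ := EuclideanSpace.basisFun (Fin 9) ℝ

lemma inner_br_stdBasis (i j k : Fin 9) :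
    inner ℝ (br (stdBasis i) (stdBasis j)) (stdBasis k) = structConst i j k := by
  rw [real_inner_comm, ← rigidBr_basis, br_eq_rigidBr, EuclideanSpace.basisFun_apply,
    EuclideanSpace.basisFun_apply, EuclideanSpace.basisFun_apply, EuclideanSpace.inner_single_left]
  simp

lemma inner_lcProd_stdBasis (i j k : Fin 9) :
    inner ℝ (lcProd (stdBasis i) (stdBasis j)) (stdBasis k) = connCoeff i j k / 2 := by
  rw [inner_lcProd, inner_br_stdBasis, real_inner_comm, inner_br_stdBasis, real_inner_comm,
    inner_br_stdBasis, connCoeff]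
  push_cast
  ring

lemma ricci_stdBasis (j k : Fin 9) :
    ∑ i, inner ℝ (lcCurv (stdBasis i) (stdBasis j) (stdBasis k)) (stdBasis i) =
      if j = k then (if j.1 < 5 then -4 else 5 / 2 : ℝ) else 0 := by
  have h := congrArg (fun n : ℤ ↦ (n / 4 : ℝ)) (structConst_ricci j k)
  simp only [lcCurv, inner_sub_left, inner_lcProd_lcProd, inner_lcProd_br, inner_br_stdBasis,
    inner_lcProd_stdBasis]
  calc _ = ((∑ i, ((∑ m, connCoeff j k m * connCoeff i m i)
    - (∑ m, connCoeff i k m * connCoeff j m i) - ∑ m, 2 * structConst i j m * connCoeff m k i)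
      : ℤ) / 4 : ℝ) := by
        push_cast
        rw [Finset.sum_div]
        refine Finset.sum_congr rfl fun i _ ↦ ?_
        rw [sub_div, sub_div, Finset.sum_div, Finset.sum_div, Finset.sum_div]
        congr 1
        · congr 1 <;> exact Finset.sum_congr rfl fun m _ ↦ by ring
        · exact Finset.sum_congr rfl fun m _ ↦ by ring
    _ = _ := h
    _ = _ := by
        split_ifs <;> norm_num

/-- The derivation of the Lie algebra which gives the soliton vector field. -/
def solitonDerivation : E₉ →L[ℝ] E₉ :=
  LinearMap.toContinuousLinearMap
    { toFun x := WithLp.toLp 2 fun i ↦ (if i.1 < 5 then -13 / 2 else -13 : ℝ) * x i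
      map_add' x y := by ext i; simp [mul_add]
      map_smul' c x := by ext i; simp [mul_left_comm] }

lemma solitonDerivation_apply (x : E₉) (i : Fin 9) :
    solitonDerivation x i = (if i.1 < 5 then -13 / 2 else -13 : ℝ) * x i := rfl

/-- The weight on the center is twice the weight on `ℝ⁵`. -/
lemma solitonDerivation_br (x y : E₉) :
    solitonDerivation (br x y) = br (solitonDerivation x) y + br x (solitonDerivation y) := by
  ext k
  simp only [br_eq_rigidBr, solitonDerivation_apply, PiLp.add_apply, rigidBr_apply,
    ← Finset.sum_add_distrib, Finset.mul_sum]
  refine Finset.sum_congr rfl fun i _ ↦ Finset.sum_congr rfl fun j _ ↦ ?_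
  by_cases h : i.1 < 5 ∧ j.1 < 5 ∧ 5 ≤ k.1
  · rw [if_pos h.1, if_pos h.2.1, if_neg h.2.2.not_gt]
    ring
  · simp [structConst, h]

theorem admitsRicciSoliton_rigid : AdmitsRicciSoliton E₉ E₉ := by
  -- With weights `a` on `ℝ⁵` and `2 a` on the center, the soliton condition is `-4 + a = 5/2 + 2 a
  -- = c`, so `a = -13/2` and `c = -21/2`.
  refine ⟨invMetric E₉, isLeftInvariant, isRicciSoliton_of_basis stdBasis solitonDerivation
    solitonDerivation_br (-21 / 2) fun j k ↦ ?_⟩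
  have h (i : Fin 9) : solitonDerivation (stdBasis i) =
      (if i.1 < 5 then -13 / 2 else -13 : ℝ) • stdBasis i := by
    ext l
    rw [solitonDerivation_apply]
    rw [PiLp.smul_apply, smul_eq_mul, EuclideanSpace.basisFun_apply]
    by_cases hl : l = i <;> simp [hl]
  rw [ricci_stdBasis, h, h, real_inner_smul_left, real_inner_smul_right,
    orthonormal_iff_ite.1 stdBasis.orthonormal]
  by_cases hjk : j = k
  · subst hjk
    by_cases hj : j.1 < 5 <;> simp [hj] <;> norm_num
  · simp [hjk]

/-! ### Infinitesimal rigidity -/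

/-- Up to multiples of the grading, a derivation of the Lie algebra vanishes on `ℝ⁵ ⊕ ℝ⁴`, modulo
maps from `ℝ⁵` to `ℝ⁴`. -/
lemma derivation_eq_zero (X : Fin 5 → Fin 5 → ℝ) (Y : Fin 4 → Fin 4 → ℝ) (hX : ∑ i, X i i = 0)
    (h : ∀ i j l, ∑ p, jMat l p j * X p i + ∑ p, jMat l i p * X p j - ∑ k, jMat k i j * Y l k = 0) :
    X = 0 ∧ Y = 0 := by
  -- The equations are antisymmetric in `i, j`, so the ten pairs `i < j` suffice. With the trace
  -- condition this is a square system: 41 equations in 25 + 16 unknowns.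
  have h01 := h 0 1
  have h02 := h 0 2
  have h03 := h 0 3
  have h04 := h 0 4
  have h12 := h 1 2
  have h13 := h 1 3
  have h14 := h 1 4
  have h23 := h 2 3
  have h24 := h 2 4
  have h34 := h 3 4
  clear h
  simp [Fin.forall_fin_succ, Fin.sum_univ_succ, jMat] at h01 h02 h03 h04 h12 h13 h14 h23 h24 h34 hX
  obtain ⟨h010, h011, h012, h013⟩ := h01
  obtain ⟨h020, h021, h022, h023⟩ := h02
  obtain ⟨h030, h031, h032, h033⟩ := h03
  obtain ⟨h040, h041, h042, h043⟩ := h04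
  obtain ⟨h120, h121, h122, h123⟩ := h12
  obtain ⟨h130, h131, h132, h133⟩ := h13
  obtain ⟨h140, h141, h142, h143⟩ := h14
  obtain ⟨h230, h231, h232, h233⟩ := h23
  obtain ⟨h240, h241, h242, h243⟩ := h24
  obtain ⟨h340, h341, h342, h343⟩ := h34
  -- Gaussian elimination: each entry is a rational combination of the equations and of entries
  -- already known to vanish.
  have x42 : X 4 2 = 0 := by linear_combination 1 / 10 * h242 + 1 / 5 * h020 - 1 / 6 * h123 - 1
    / 10 * h230 + 1 / 5 * h120 - 1 / 6 * h023 + 1 / 6 * h021 + 1 / 5 * h022 + 1 / 6 * h121 + 1 / 5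
    * h122 - 1 / 10 * h232 + 1 / 10 * h240
  have x32 : X 3 2 = 0 := by linear_combination -1 / 3 * h021 - 1 / 3 * h121 + 1 / 3 * h123 + 1
    / 3 * h023 + x42
  have x12 : X 1 2 = 0 := by linear_combination 1 / 2 * h020 + 1 / 2 * h022 + 1 / 2 * h122 + 1 /
    2 * h120 - 1 / 6 * h243 - 1 / 6 * h231 + 1 / 6 * h241 + 1 / 6 * h233 - x42 - x32
  have x02 : X 0 2 = 0 := by linear_combination -h022 - h122 - h120 - h020 + x12 + 2 * x42 + 2 * x32
  have x22 : X 2 2 = 0 := by linear_combination 1 / 3 * h141 + 1 / 15 * h031 + 1 / 5 * hX + 1 /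
    3 * h033 - 1 / 5 * h121 + 1 / 15 * h143 - 1 / 15 * h041 + 1 / 15 * h131 - 1 / 15 * h133 + 1 /
    15 * h043 - 1 / 5 * h340 + 1 / 5 * h023 + 1 / 5 * h010 + 1 / 5 * h230 - 1 / 5 * h242 - 1 / 5 *
    h012 + 1 / 5 * h342 - 1 / 5 * x32 + 2 / 5 * x42 - 1 / 5 * x12 + 1 / 5 * x02
  have x21 : X 2 1 = 0 := by linear_combination -4 / 15 * h142 - 1 / 10 * h022 + 1 / 15 * h020 -
    1 / 15 * h010 - 1 / 30 * h230 - 1 / 10 * h030 + 1 / 15 * h032 + 1 / 6 * h241 - 1 / 10 * h341 -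
    1 / 30 * h232 + 7 / 30 * h011 + 1 / 15 * h013 + 7 / 30 * h140 + 1 / 15 * h342 + 1 / 15 * h042
    - 1 / 30 * h041 - 1 / 30 * h043 - 1 / 30 * h133 - 1 / 30 * h131 - 1 / 10 * h132 + 1 / 10 *
    h130 - 1 / 15 * h040 + 1 / 15 * h343 + 1 / 6 * x12 - 1 / 6 * x02
  have x20 : X 2 0 = 0 := by linear_combination -1 / 6 * h011 - 1 / 6 * h020 + 1 / 6 * h013 - 1
    / 3 * h032 + 1 / 3 * h030 - 1 / 3 * h140 - 1 / 6 * h343 - 1 / 6 * h241 + 1 / 6 * h341 + 1 / 3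
    * h142 - 1 / 6 * h120 - 1 / 6 * h042 - 1 / 6 * h130 + 1 / 6 * h132 + 1 / 6 * h040 + 1 / 6 *
    h233 + x21 + 1 / 6 * x42 + 1 / 6 * x02 + 1 / 6 * x32 - 1 / 6 * x12
  have x23 : X 2 3 = 0 := by linear_combination 1 / 3 * h013 + 1 / 6 * h140 - 1 / 6 * h240 + 1 /
    6 * h030 + 1 / 6 * h023 + 1 / 6 * h233 - 1 / 6 * h141 + 1 / 6 * h031 - 1 / 6 * h032 + 1 / 3 *
    h033 - 1 / 6 * h133 + 1 / 6 * h241 + 1 / 3 * h011 - 1 / 6 * h010 - 1 / 6 * h120 - 1 / 6 * h142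
    - 1 / 6 * h131 + 1 / 6 * h340 - 1 / 6 * h022 - x20 - x21 + 1 / 3 * x32 + 1 / 3 * x42
  have y13 : Y 1 3 = 0 := by linear_combination 1 / 3 * h031 + 1 / 3 * h033 + 1 / 3 * h121 + 1 /
    3 * h143 - 1 / 3 * h123 - 1 / 3 * h131 + 1 / 3 * h041 - x23 + 2 / 3 * x32 - 1 / 3 * x42
  have x24 : X 2 4 = 0 := by linear_combination -1 / 6 * h133 + 1 / 6 * h230 + 1 / 3 * h033 - 1
    / 2 * h141 - 1 / 6 * h240 + 1 / 6 * h121 + 1 / 6 * h021 - 1 / 3 * h143 + 1 / 6 * h043 - 1 / 2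
    * x23 - 1 / 6 * x12 + 1 / 2 * y13 + 1 / 6 * x02 + 1 / 2 * x32
  have y11 : Y 1 1 = 0 := by linear_combination 1 / 2 * h141 - 1 / 2 * h041 + 1 / 2 * h131 + 1 /
    2 * hX + x24 + 1 / 2 * y13 + 1 / 2 * x23 - 1 / 2 * x22
  have y02 : Y 0 2 = 0 := by linear_combination -1 / 5 * h130 + 1 / 5 * h232 - 1 / 5 * h342 + 1
    / 5 * h012 + 1 / 5 * h340 - 2 / 5 * h010 + 1 / 5 * h230 - 1 / 5 * h040 + 1 / 5 * x21 - 2 / 5 *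
    x12 - 2 / 5 * x23 + 2 / 5 * x24 + 1 / 5 * x42 + 1 / 5 * x20
  have y00 : Y 0 0 = 0 := by linear_combination -1 / 2 * h240 - 1 / 2 * h242 + 1 / 2 * h342 + 1
    / 2 * h010 + 1 / 2 * hX - 1 / 2 * h340 - 1 / 2 * h012 + x02 - 1 / 2 * x22 + 1 / 2 * x32 + y02
    + x23 - x24
  have y31 : Y 3 1 = 0 := by linear_combination 1 / 2 * h031 + h033 + 1 / 2 * h021 + 1 / 2 *
    h230 - 3 / 2 * x23 - x22 + 1 / 2 * x32 + 1 / 2 * y13 - 1 / 2 * x12 + 1 / 2 * y00 - 1 / 2 * y02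
  have y33 : Y 3 3 = 0 := by linear_combination h143 + h240 + 2 * h141 - h121 + 3 * x24 - x02 -
    2 * x22 - 2 * x32 + y00 - y02 - y13 + y11
  have x30 : X 3 0 = 0 := by linear_combination -1 / 15 * h233 - 1 / 5 * h020 - 7 / 15 * h010 -
    2 / 15 * h013 - 1 / 15 * h033 + 1 / 15 * h133 - 1 / 15 * h230 + 1 / 15 * h030 - 1 / 5 * h120 +
    2 / 15 * h011 + 1 / 15 * h123 - 1 / 15 * h041 + 1 / 15 * h231 - 1 / 15 * h140 + 1 / 15 * h040
    + 1 / 5 * x12 + 1 / 5 * x42 - 1 / 3 * y02 - 2 / 15 * x20 + 1 / 15 * x21 + 2 / 15 * x23 - 1 /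
    15 * y31 + 2 / 15 * x22 + 2 / 15 * x32 + 1 / 15 * x24 - 1 / 15 * y11 + 1 / 15 * y13 + 1 / 15 *
    x02
  have x41 : X 4 1 = 0 := by linear_combination h010 + x30 + y02
  have x03 : X 0 3 = 0 := by linear_combination -1 / 5 * h033 - 1 / 5 * h141 + 2 / 5 * h340 - 2
    / 5 * h230 + 1 / 5 * h142 - 2 / 5 * h240 + 1 / 5 * h032 - 4 / 15 * h231 - 4 / 15 * h011 - 4 /
    15 * h122 + 4 / 15 * h341 - 1 / 15 * h343 + 1 / 15 * h013 - 1 / 15 * h022 + 1 / 15 * h243 - 1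
    / 5 * x23 + 1 / 5 * y31 + 1 / 5 * x24 + 1 / 5 * y13 - 2 / 5 * y00 + 4 / 15 * x12 + 4 / 5 * x22
    - 1 / 3 * x42 + 4 / 5 * y02 + 2 / 5 * x21 - 1 / 15 * x02 + 2 / 3 * x32 + 2 / 5 * x20 + 2 / 5 *
    x30 + 3 / 5 * x41
  have x14 : X 1 4 = 0 := by linear_combination -1 / 3 * h343 + 1 / 3 * h013 - 1 / 3 * h022 - 1
    / 3 * h122 - 1 / 3 * h231 - 1 / 3 * h011 + 1 / 3 * h341 + 1 / 3 * h243 - x03 + x30 + x41 + 1 /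
    3 * x12 + 1 / 3 * x42 - 1 / 3 * x02 + 1 / 3 * x32
  have y20 : Y 2 0 = 0 := by linear_combination -h342 + x03 - x14 - x23 + x24
  have y22 : Y 2 2 = 0 := by linear_combination h240 + h242 - h342 - 2 * x02 - x32 + y00 - y02 +
    x03 - x14 - x23 + x24
  have y03 : Y 0 3 = 0 := by linear_combination -1 / 3 * h130 - 1 / 3 * h123 + 1 / 3 * h242 + 1
    / 3 * h340 + 1 / 3 * h140 + 1 / 3 * h120 - 1 / 3 * y02 - 1 / 3 * x42 + 1 / 3 * y31 + 1 / 3 *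
    y33 - 1 / 3 * x02 + 1 / 3 * y20 - 1 / 3 * y22 - 1 / 3 * x03 + 1 / 3 * x14 - 1 / 3 * x23 + 1 /
    3 * x24
  have y01 : Y 0 1 = 0 := by linear_combination 1 / 3 * h030 - 1 / 3 * h230 + 1 / 3 * h340 + 1 /
    3 * h021 - 1 / 3 * h020 - 1 / 3 * h040 + 1 / 3 * x12 - 1 / 3 * x42 - 1 / 3 * y00 - 1 / 3 * x03
    + 1 / 3 * x14 - 1 / 3 * x23 + 1 / 3 * x24 + 1 / 3 * x32 + 1 / 3 * y11 + 1 / 3 * y13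
  have x40 : X 4 0 = 0 := by linear_combination -h020 - x30 + x42 - y01 - y03
  have x01 : X 0 1 = 0 := by linear_combination 1 / 2 * h141 + 1 / 2 * h140 + 1 / 2 * h120 + 1 /
    2 * x24 - 1 / 2 * y13 - 1 / 2 * x21 - y03 - 1 / 2 * x32 + 1 / 2 * x41 - 1 / 2 * y01
  have x10 : X 1 0 = 0 := by linear_combination 1 / 2 * h030 - 1 / 2 * h020 + 1 / 2 * h033 - 1 /
    2 * x20 - y01 - 1 / 2 * x30 + 1 / 2 * x42 - 1 / 2 * y03 - 1 / 2 * x23 - 1 / 2 * y31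
  have x43 : X 4 3 = 0 := by linear_combination -1 / 2 * h033 + 1 / 2 * h030 - 1 / 2 * h020 + 1
    / 2 * x23 + 1 / 2 * y31 - 1 / 2 * x20 - y01 - 1 / 2 * x30 + 1 / 2 * x42 - 1 / 2 * y03
  have x34 : X 3 4 = 0 := by linear_combination 1 / 2 * h140 - 1 / 2 * h141 + 1 / 2 * h120 - 1 /
    2 * x21 - y03 - 1 / 2 * x24 + 1 / 2 * y13 - 1 / 2 * x32 + 1 / 2 * x41 - 1 / 2 * y01
  have y32 : Y 3 2 = 0 := by linear_combination -h013 - h020 + x20 + x21 - 2 * x30 - x41 + x42 -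
    y01 - y03
  have x31 : X 3 1 = 0 := by linear_combination -h120 + x32 - x41 + y01 + y03
  have y12 : Y 1 2 = 0 := by linear_combination -h011 + h120 + x20 + x21 + x30 + 2 * x41 - x32 -
    y01 - y03
  have y21 : Y 2 1 = 0 := by linear_combination -1 / 2 * h233 + h032 + 1 / 2 * h343 + 1 / 2 *
    x12 + 1 / 2 * y32 - x10 + x20 - x43 + 1 / 2 * x14
  have x13 : X 1 3 = 0 := by linear_combination 1 / 2 * h233 - 1 / 2 * h343 - 1 / 2 * x12 - 1 /
    2 * y32 - 1 / 2 * x14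
  have x00 : X 0 0 = 0 := by linear_combination h021 + x10 - x22 + x32 - x42 + y11 + y13
  have y23 : Y 2 3 = 0 := by linear_combination h142 + 1 / 2 * h341 - 1 / 2 * h241 - x01 + x21 -
    x34 - 1 / 2 * x03 + 1 / 2 * x02 + 1 / 2 * y12
  have y30 : Y 3 0 = 0 := by linear_combination -1 / 2 * h343 - 1 / 2 * h233 - x03 - 1 / 2 * x14
    + 1 / 2 * x12 + 1 / 2 * y32
  have x11 : X 1 1 = 0 := by linear_combination -h121 + x01 - x22 - x32 + y11 + y13
  have x33 : X 3 3 = 0 := by linear_combination -h232 + x12 - x22 - x43 - y20 + y22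
  have x44 : X 4 4 = 0 := by linear_combination h240 - x02 - x22 - x32 - x34 + y00 - y02
  have y10 : Y 1 0 = 0 := by linear_combination -1 / 2 * h241 - 1 / 2 * h341 + 1 / 2 * x02 + x14
    + 1 / 2 * y12 + 1 / 2 * x03
  have x04 : X 0 4 = 0 := by linear_combination 1 / 2 * h341 - 1 / 2 * h241 - 1 / 2 * x03 + 1 /
    2 * x02 + 1 / 2 * y12
  refine ⟨funext fun i ↦ funext fun j ↦ ?_, funext fun i ↦ funext fun j ↦ ?_⟩ <;>
    fin_cases i <;> fin_cases j <;> assumption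

/-! ### Block coordinates and the center -/

/-- The indices of the basis vectors of `ℝ⁵` in `ℝ⁹`. -/
abbrev vIdx (i : Fin 5) : Fin 9 := Fin.castAdd 4 i

/-- The indices of the basis vectors of the center in `ℝ⁹`. -/
abbrev zIdx (l : Fin 4) : Fin 9 := Fin.natAdd 5 l

lemma sum_vIdx_add_sum_zIdx {M : Type*} [AddCommMonoid M] (f : Fin 9 → M) :
    ∑ m, f m = ∑ i, f (vIdx i) + ∑ l, f (zIdx l) := Fin.sum_univ_add (a := 5) (b := 4) f

lemma forall_fin_nine {p : Fin 9 → Prop} :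
    (∀ m, p m) ↔ (∀ i, p (vIdx i)) ∧ ∀ l, p (zIdx l) :=
  ⟨fun h ↦ ⟨fun _ ↦ h _, fun _ ↦ h _⟩, fun h m ↦ Fin.addCases (m := 5) (n := 4) h.1 h.2 m⟩

lemma mem_rigidCenter_iff_vIdx {x : E₉} : x ∈ rigidCenter ↔ ∀ i, x (vIdx i) = 0 :=
  ⟨fun h i ↦ h _ i.2, fun h i hi ↦ h ⟨i, hi⟩⟩

lemma structConst_vIdx : ∀ i j l, structConst (vIdx i) (vIdx j) (zIdx l) = jMat l i j := by
  decide +kernel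

lemma rigidBr_zIdx (x y : E₉) (l : Fin 4) :
    rigidBr x y (zIdx l) = ∑ p, ∑ q, jMat l p q * (x (vIdx p) * y (vIdx q)) := by
  have h (k : Fin 4) (j m : Fin 9) : structConst (zIdx k) j m = 0 :=
    structConst_eq_zero_of_le (by simp) j m
  have h' (k : Fin 4) (j m : Fin 9) : structConst j (zIdx k) m = 0 := by
    rw [structConst_swap, h, neg_zero]
  simp only [rigidBr_apply, sum_vIdx_add_sum_zIdx, h, h', structConst_vIdx]
  simp

/-- At each of the positions `(3,4)`, `(0,3)`, `(0,1)`, `(1,4)` exactly one of the four matrices has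
a nonzero entry, so each central basis vector is, up to sign, a single bracket of basis vectors. -/
lemma zIdx_eq_structConst : ∀ l k, (if k = zIdx l then 1 else 0) =
    (![1, -1, 1, -1] : Fin 4 → ℤ) l *
      structConst ((![3, 0, 0, 1] : Fin 4 → Fin 9) l) ((![4, 3, 1, 4] : Fin 4 → Fin 9) l) k := by
  decide +kernel

lemma single_zIdx (l : Fin 4) : ∃ (c : ℝ) (x y : E₉),
    EuclideanSpace.single (zIdx l) (1 : ℝ) = c • rigidBr x y := by
  refine ⟨(![1, -1, 1, -1] : Fin 4 → ℤ) l,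
    EuclideanSpace.single ((![3, 0, 0, 1] : Fin 4 → Fin 9) l) 1,
    EuclideanSpace.single ((![4, 3, 1, 4] : Fin 4 → Fin 9) l) 1, ?_⟩
  ext k
  rw [PiLp.smul_apply, smul_eq_mul, rigidBr_basis, ← Int.cast_mul, ← zIdx_eq_structConst l k]
  simp

lemma eq_sum_single (x : E₉) : x = ∑ m, x m • EuclideanSpace.single m (1 : ℝ) := by
  simpa using (stdBasis.sum_repr x).symm

/-- The center is the commutator ideal. -/
lemma rigidCenter_eq_span :
    rigidCenter = Submodule.span ℝ {z | ∃ x y : E₉, rigidBr x y = z} := by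
  refine le_antisymm (fun z hz ↦ ?_) (Submodule.span_le.2 ?_)
  · rw [eq_sum_single z, sum_vIdx_add_sum_zIdx]
    refine add_mem (sum_mem fun i _ ↦ ?_) (sum_mem fun l _ ↦ ?_)
    · rw [mem_rigidCenter_iff_vIdx.1 hz i, zero_smul]
      exact zero_mem _
    · obtain ⟨c, x, y, h⟩ := single_zIdx l
      rw [h]
      exact Submodule.smul_mem _ _ (Submodule.smul_mem _ _ (Submodule.subset_span ⟨x, y, rfl⟩))
  · rintro _ ⟨x, y, rfl⟩
    exact rigidBr_mem x y

/-- The center is isomorphic to `ℝ⁴`. -/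
def rigidCenterEquiv : rigidCenter ≃ₗ[ℝ] (Fin 4 → ℝ) where
  toFun x l := x.1 (zIdx l)
  map_add' x y := by ext; simp
  map_smul' c x := by ext; simp
  invFun y := ⟨∑ l, y l • EuclideanSpace.single (zIdx l) (1 : ℝ),
    sum_mem fun l _ ↦ rigidCenter.smul_mem _ fun i hi ↦ by
      have h : i ≠ zIdx l := fun h ↦ by simp [h] at hi
      simp [h]⟩
  left_inv x := by
    ext1
    conv_rhs => rw [eq_sum_single x.1, sum_vIdx_add_sum_zIdx]
    simp [mem_rigidCenter_iff_vIdx.1 x.2]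
  right_inv y := by
    ext l
    have h (k : Fin 4) : zIdx l = zIdx k ↔ l = k := (Fin.natAdd_injective 4 5).eq_iff
    simp [Pi.single_apply, h]

lemma finrank_rigidCenter : Module.finrank ℝ rigidCenter = 4 := by
  rw [rigidCenterEquiv.finrank_eq, Module.finrank_fin_fun]

/-! ### Automorphisms close to the identity -/

/-- The linearization of the automorphism equations, together with the trace. -/
def autLin : (Fin 5 → Fin 5 → ℝ) × (Fin 4 → Fin 4 → ℝ) →ₗ[ℝ] (Fin 5 → Fin 5 → Fin 4 → ℝ) × ℝ where
  toFun w := (fun i j l ↦ ∑ p, jMat l p j * w.1 p i + ∑ p, jMat l i p * w.1 p j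
    - ∑ k, jMat k i j * w.2 l k, ∑ i, w.1 i i)
  map_add' w w' := by
    ext i j l
    · simp only [Prod.fst_add, Prod.snd_add, Pi.add_apply, mul_add, Finset.sum_add_distrib]
      ring
    · simp [Finset.sum_add_distrib]
  map_smul' c w := by
    ext i j l
    · simp only [Prod.smul_fst, Prod.smul_snd, Pi.smul_apply, smul_eq_mul, mul_left_comm _ c,
        ← Finset.mul_sum, RingHom.id_apply]
      ring
    · simp [Finset.mul_sum]

lemma autLin_injective : LinearMap.ker autLin = ⊥ := by
  refine LinearMap.ker_eq_bot'.2 fun w hw ↦ ?_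
  have h := derivation_eq_zero w.1 w.2 (congrArg Prod.snd hw)
    fun i j l ↦ congrFun (congrFun (congrFun (congrArg Prod.fst hw) i) j) l
  exact Prod.ext h.1 h.2

lemma abs_jMat_le : ∀ l i j, |jMat l i j| ≤ 1 := by decide +kernel

/-- Here `1 + X` and `1 + Y` are the diagonal blocks of an automorphism, up to rescaling. The linear
part of the equation is injective, hence bounded below, while the remainder is quadratic in `X`; so
no small nonzero solution exists. -/
lemma exists_rigidity_radius : ∃ ε > 0, ∀ (X : Fin 5 → Fin 5 → ℝ) (Y : Fin 4 → Fin 4 → ℝ),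
    ‖X‖ < ε → ∑ i, X i i = 0 →
    (∀ i j l, ∑ p, jMat l p j * X p i + ∑ p, jMat l i p * X p j - ∑ k, jMat k i j * Y l k
      = -∑ p, ∑ q, jMat l p q * (X p i * X q j)) → X = 0 ∧ Y = 0 := by
  obtain ⟨K, hK, hL⟩ := LinearMap.exists_antilipschitzWith autLin autLin_injective
  -- The quadratic term has 25 summands with coefficients at most 1, so `‖X‖ ≤ 25 K ‖X‖²`, which
  -- forces `X = 0` below this radius.
  refine ⟨1 / (25 * K), by positivity, fun X Y hX htr h ↦ ?_⟩
  have hQ (i j l) : |∑ p, ∑ q, jMat l p q * (X p i * X q j)| ≤ 25 * ‖X‖ ^ 2 := by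
    have hle (p i : Fin 5) : |X p i| ≤ ‖X‖ :=
      (norm_le_pi_norm (X p) i).trans (norm_le_pi_norm X p)
    calc _ ≤ ∑ p : Fin 5, ∑ q : Fin 5, ‖X‖ ^ 2 := by
          refine (Finset.abs_sum_le_sum_abs _ _).trans (Finset.sum_le_sum fun p _ ↦ ?_)
          refine (Finset.abs_sum_le_sum_abs _ _).trans (Finset.sum_le_sum fun q _ ↦ ?_)
          have h1 : |(jMat l p q : ℝ)| ≤ 1 := by exact_mod_cast abs_jMat_le l p q
          rw [abs_mul, abs_mul, sq, ← one_mul (‖X‖ * ‖X‖)]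
          have := hle p i
          have := hle q j
          gcongr
      _ = _ := by simp; ring
  have hbound : ‖(X, Y)‖ ≤ K * (25 * ‖X‖ ^ 2) := by
    have h1 : ‖autLin (X, Y)‖ ≤ 25 * ‖X‖ ^ 2 := by
      refine max_le ?_ ?_
      · refine (pi_norm_le_iff_of_nonneg (by positivity)).2 fun i ↦
          (pi_norm_le_iff_of_nonneg (by positivity)).2 fun j ↦
          (pi_norm_le_iff_of_nonneg (by positivity)).2 fun l ↦ ?_
        have h2 := hQ i j l
        rw [← abs_neg, ← h i j l] at h2
        exact h2
      · have h2 : (autLin (X, Y)).2 = 0 := htr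
        rw [h2, norm_zero]
        positivity
    have h3 := hL.le_mul_dist (X, Y) 0
    rw [map_zero, dist_zero_right, dist_zero_right] at h3
    exact h3.trans (by gcongr)
  have hX0 : ‖X‖ = 0 := by
    have h1 : ‖X‖ ≤ K * (25 * ‖X‖ ^ 2) := (norm_fst_le (X, Y)).trans hbound
    have h2 : ‖X‖ * (25 * K) < 1 := by rwa [lt_div_iff₀ (by positivity)] at hX
    nlinarith [norm_nonneg X]
  rw [hX0] at hbound
  have h0 : (X, Y) = 0 := norm_le_zero_iff.1 (by simpa using hbound)
  exact ⟨congrArg Prod.fst h0, congrArg Prod.snd h0⟩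

/-- The linear map `f` acts on `Z` by `u` and on the quotient by `Z` by `s`. -/
def IsScalingOn {L : Type*} [AddCommGroup L] [Module ℝ L] (Z : Submodule ℝ L) (s u : ℝ)
    (f : L →ₗ[ℝ] L) : Prop :=
  (∀ x, f x - s • x ∈ Z) ∧ ∀ z ∈ Z, f z = u • z

lemma apply_eq_sum_single (f : E₉ →ₗ[ℝ] E₉) (x : E₉) (k : Fin 9) :
    f x k = ∑ m, x m * f (EuclideanSpace.single m 1) k := by
  conv_lhs => rw [eq_sum_single x, map_sum]
  simp

lemma automorphism_mem_rigidCenter {f : E₉ →ₗ[ℝ] E₉}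
    (hf : ∀ x y, f (rigidBr x y) = rigidBr (f x) (f y)) (l : Fin 4) :
    f (EuclideanSpace.single (zIdx l) 1) ∈ rigidCenter := by
  obtain ⟨c, x, y, h⟩ := single_zIdx l
  rw [h, map_smul, hf]
  exact rigidCenter.smul_mem _ (rigidBr_mem _ _)

/-- The automorphism equations for the diagonal blocks of `f`. -/
lemma automorphism_equation {f : E₉ →ₗ[ℝ] E₉}
    (hf : ∀ x y, f (rigidBr x y) = rigidBr (f x) (f y)) (i j : Fin 5) (l : Fin 4) :
    ∑ p, ∑ q, jMat l p q * (f (EuclideanSpace.single (vIdx i) 1) (vIdx p) *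
      f (EuclideanSpace.single (vIdx j) 1) (vIdx q)) =
    ∑ k, jMat k i j * f (EuclideanSpace.single (zIdx k) 1) (zIdx l) := by
  rw [← rigidBr_zIdx, ← hf, apply_eq_sum_single]
  simp only [rigidBr_basis, sum_vIdx_add_sum_zIdx, structConst_vIdx]
  rw [add_eq_right]
  exact Finset.sum_eq_zero fun p _ ↦ by
    rw [structConst_eq_zero_of_lt _ _ (by simp), Int.cast_zero, zero_mul]

/-- An automorphism whose diagonal blocks are scalar acts by scalars on the center and on the
quotient by the center. -/
lemma isScalingOn_of_blocks {f : E₉ →ₗ[ℝ] E₉}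
    (hf : ∀ x y, f (rigidBr x y) = rigidBr (f x) (f y)) {s u : ℝ}
    (hs : ∀ i p, f (EuclideanSpace.single (vIdx i) 1) (vIdx p) = if p = i then s else 0)
    (hu : ∀ k l, f (EuclideanSpace.single (zIdx k) 1) (zIdx l) = if l = k then u else 0) :
    IsScalingOn rigidCenter s u f := by
  have hz (k : Fin 4) (p : Fin 5) : f (EuclideanSpace.single (zIdx k) 1) (vIdx p) = 0 :=
    mem_rigidCenter_iff_vIdx.1 (automorphism_mem_rigidCenter hf k) p
  have hv (x : E₉) (p : Fin 5) : f x (vIdx p) = s * x (vIdx p) := by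
    rw [apply_eq_sum_single, sum_vIdx_add_sum_zIdx]
    simp [hs, hz, mul_comm]
  refine ⟨fun x ↦ mem_rigidCenter_iff_vIdx.2 fun p ↦ ?_, fun z hz' ↦ ?_⟩
  · simp [hv]
  · have hz0 := mem_rigidCenter_iff_vIdx.1 hz'
    ext k
    revert k
    refine forall_fin_nine.2 ⟨fun p ↦ ?_, fun l ↦ ?_⟩
    · simp [hv, hz0]
    · rw [apply_eq_sum_single, sum_vIdx_add_sum_zIdx]
      simp [hz0, hu, mul_comm]

/-- Automorphisms of the Lie algebra close to the identity act by scalars on the center and on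
the quotient by the center. -/
theorem eventually_isScalingOn : ∀ᶠ M in nhds (1 : Matrix (Fin 9) (Fin 9) ℝ),
    ∀ f : E₉ →ₗ[ℝ] E₉, (∀ i k, f (EuclideanSpace.single i 1) k = M k i) →
      (∀ x y, f (rigidBr x y) = rigidBr (f x) (f y)) →
      ∃ t > 0, IsScalingOn rigidCenter t (t ^ 2) f := by
  obtain ⟨ε, hε, hrig⟩ := exists_rigidity_radius
  -- Dividing the `ℝ⁵` block by its mean diagonal entry `τ` makes `ξ` traceless, which removes the
  -- grading direction. The central block is correspondingly divided by `τ ^ 2`.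
  let τ : Matrix (Fin 9) (Fin 9) ℝ → ℝ := fun M ↦ (∑ i, M (vIdx i) (vIdx i)) / 5
  let ξ : Matrix (Fin 9) (Fin 9) ℝ → Fin 5 → Fin 5 → ℝ :=
    fun M p i ↦ M (vIdx p) (vIdx i) / τ M - if p = i then 1 else 0
  have hent (p i : Fin 9) : Continuous fun M : Matrix (Fin 9) (Fin 9) ℝ ↦ M p i :=
    continuous_id.matrix_elem p i
  have hτ : Continuous τ := (continuous_finsetSum _ fun i _ ↦ hent _ _).div_const 5
  have hτ1 : τ 1 = 1 := by simp [τ]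
  have hξ : ContinuousAt ξ 1 := continuousAt_pi.2 fun p ↦ continuousAt_pi.2 fun i ↦
    ((hent _ _).continuousAt.div hτ.continuousAt (by simp [hτ1])).sub continuousAt_const
  have hv (p i : Fin 5) : vIdx p = vIdx i ↔ p = i := (Fin.castAdd_injective 5 4).eq_iff
  have hξ1 : ξ 1 = 0 := by
    ext p i
    simp [ξ, hτ1, Matrix.one_apply, hv]
  have e1 : ∀ᶠ M in nhds 1, 0 < τ M :=
    hτ.continuousAt.eventually (lt_mem_nhds (by simp [hτ1]))
  have e2 : ∀ᶠ M in nhds 1, ‖ξ M‖ < ε :=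
    hξ.norm.eventually (gt_mem_nhds (by simpa [hξ1] using hε))
  filter_upwards [e1, e2] with M ht hX f hM hf
  set t := τ M with htdef
  let Y : Fin 4 → Fin 4 → ℝ := fun l k ↦ M (zIdx l) (zIdx k) / t ^ 2 - if l = k then 1 else 0
  have ha (p i : Fin 5) : M (vIdx p) (vIdx i) = t * ((if p = i then 1 else 0) + ξ M p i) := by
    simp only [ξ, ← htdef]
    field_simp
    ring
  have hd (l k : Fin 4) : M (zIdx l) (zIdx k) = t ^ 2 * ((if l = k then 1 else 0) + Y l k) := by
    simp only [Y]
    field_simp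
    ring
  have htr : ∑ i, ξ M i i = 0 := by
    have h : ∑ i, M (vIdx i) (vIdx i) = t * 5 := by
      rw [htdef]
      simp only [τ]
      field_simp
    simp only [ξ, ← htdef, if_true, Finset.sum_sub_distrib, ← Finset.sum_div, h]
    simp
    field_simp
    norm_num
  -- After division by `t ^ 2` the zeroth-order terms `jMat l i j` cancel, leaving the linear part
  -- equal to minus the quadratic one.
  obtain ⟨hX0, hY0⟩ := hrig (ξ M) Y hX htr fun i j l ↦ by
    have h := automorphism_equation hf i j l
    simp only [hM, ha, hd] at h
    have h1 : ∑ p, ∑ q, (jMat l p q : ℝ) * (t * ((if p = i then 1 else 0) + ξ M p i) *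
        (t * ((if q = j then 1 else 0) + ξ M q j))) = t ^ 2 * (jMat l i j
          + ∑ p, jMat l p j * ξ M p i + ∑ p, jMat l i p * ξ M p j
          + ∑ p, ∑ q, jMat l p q * (ξ M p i * ξ M q j)) := by
      have h2 (p q : Fin 5) : (jMat l p q : ℝ) * (t * ((if p = i then 1 else 0) + ξ M p i) *
          (t * ((if q = j then 1 else 0) + ξ M q j))) = t ^ 2 * ((if p = i then
            (if q = j then (jMat l p q : ℝ) else 0) else 0)
            + (if q = j then jMat l p q * ξ M p i else 0)
            + (if p = i then jMat l p q * ξ M q j else 0)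
            + jMat l p q * (ξ M p i * ξ M q j)) := by
        split_ifs <;> ring
      have h3 : ∑ p, ∑ q, (if p = i then (jMat l p q : ℝ) * ξ M q j else 0) =
          ∑ q, jMat l i q * ξ M q j := by
        rw [Finset.sum_comm]
        simp
      simp only [h2, ← Finset.mul_sum, Finset.sum_add_distrib, h3]
      simp
    have h3 : ∑ k, (jMat k i j : ℝ) * (t ^ 2 * ((if l = k then 1 else 0) + Y l k)) =
        t ^ 2 * (jMat l i j + ∑ k, jMat k i j * Y l k) := by
      simp only [mul_left_comm _ (t ^ 2), ← Finset.mul_sum, mul_add, Finset.sum_add_distrib]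
      simp
    rw [h1, h3] at h
    have h4 := mul_left_cancel₀ (pow_ne_zero 2 ht.ne') h
    linarith
  refine ⟨t, ht, isScalingOn_of_blocks hf (fun i p ↦ ?_) fun k l ↦ ?_⟩
  · rw [hM, ha, hX0]
    simp
  · rw [hM, hd, hY0]
    simp

/-! ### The identity component of the automorphism group -/

namespace IsScalingOn

variable {L : Type*} [AddCommGroup L] [Module ℝ L] {Z : Submodule ℝ L} {s u s' u' : ℝ}
  {f g : L →ₗ[ℝ] L}

lemma id : IsScalingOn Z 1 1 (LinearMap.id : L →ₗ[ℝ] L) :=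
  ⟨fun x ↦ by simp, fun z _ ↦ by simp⟩

lemma smul (c : ℝ) (hf : IsScalingOn Z s u f) : IsScalingOn Z (c * s) (c * u) (c • f) :=
  ⟨fun x ↦ by simpa [mul_smul, smul_sub] using Z.smul_mem c (hf.1 x),
    fun z hz ↦ by simp [hf.2 z hz, mul_smul]⟩

lemma comp (hf : IsScalingOn Z s u f) (hg : IsScalingOn Z s' u' g) :
    IsScalingOn Z (s * s') (u * u') (f ∘ₗ g) := by
  refine ⟨fun x ↦ ?_, fun z hz ↦ ?_⟩
  · have h : f (g x) - (s * s') • x = f (g x - s' • x) + s' • (f x - s • x) := by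
      simp only [map_sub, map_smul]
      module
    rw [LinearMap.comp_apply, h, hf.2 _ (hg.1 x)]
    exact add_mem (Z.smul_mem _ (hg.1 x)) (Z.smul_mem _ (hf.1 x))
  · rw [LinearMap.comp_apply, hg.2 z hz, map_smul, hf.2 z hz, smul_smul, mul_comm]

lemma inv (hs : s ≠ 0) (hu : u ≠ 0) (hf : IsScalingOn Z s u f) (hfg : ∀ x, f (g x) = x)
    (hgf : ∀ x, g (f x) = x) : IsScalingOn Z s⁻¹ u⁻¹ g := by
  refine ⟨fun x ↦ ?_, fun z hz ↦ ?_⟩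
  · have h : g x - s⁻¹ • x = (-s⁻¹) • (f (g x) - s • g x) := by
      rw [hfg, smul_sub, smul_smul, neg_mul, inv_mul_cancel₀ hs]
      module
    rw [h]
    exact Z.smul_mem _ (hf.1 _)
  · have h : f (u⁻¹ • z) = z := by rw [map_smul, hf.2 z hz, inv_smul_smul₀ hu]
    rw [← hgf (u⁻¹ • z), h]

/-- Conjugation by an isomorphism which preserves `Z`. -/
lemma conj (hf : IsScalingOn Z s u f) {φ ψ : L →ₗ[ℝ] L} (hφψ : ∀ x, φ (ψ x) = x)
    (hφ : ∀ x ∈ Z, φ x ∈ Z) (hψ : ∀ x ∈ Z, ψ x ∈ Z) :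
    IsScalingOn Z s u (φ ∘ₗ f ∘ₗ ψ) := by
  refine ⟨fun x ↦ ?_, fun z hz ↦ ?_⟩
  · have h : φ (f (ψ x)) - s • x = φ (f (ψ x) - s • ψ x) := by
      rw [map_sub, map_smul, hφψ]
    rw [LinearMap.comp_apply, LinearMap.comp_apply, h]
    exact hφ _ (hf.1 _)
  · rw [LinearMap.comp_apply, LinearMap.comp_apply, hf.2 _ (hψ z hz), map_smul, hφψ]

end IsScalingOn

/-! ### Groups of maps acting by scalars on `Z` and on `L ⧸ Z` -/

section ScalingGroups

variable {L : Type*} [AddCommGroup L] [Module ℝ L] {n : ℕ} (b : Module.Basis (Fin n) ℝ L)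
  (Z : Submodule ℝ L)

lemma toLin_toLin_inv (A : GL (Fin n) ℝ) (x : L) :
    Matrix.toLin b b A (Matrix.toLin b b (A⁻¹ : GL (Fin n) ℝ) x) = x := by
  rw [← Matrix.toLin_mul_apply, ← Units.val_mul, mul_inv_cancel]
  simp

lemma toLin_inv_toLin (A : GL (Fin n) ℝ) (x : L) :
    Matrix.toLin b b (A⁻¹ : GL (Fin n) ℝ) (Matrix.toLin b b A x) = x := by
  rw [← Matrix.toLin_mul_apply, ← Units.val_mul, inv_mul_cancel]
  simp

/-- The group of linear maps which act by a scalar `t > 0` on `L ⧸ Z` and by `t²` on `Z`. -/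
def gradedGL : Subgroup (GL (Fin n) ℝ) where
  carrier := {A | ∃ t > 0, IsScalingOn Z t (t ^ 2) (Matrix.toLin b b A)}
  mul_mem' := by
    rintro A B ⟨s, hs, hA⟩ ⟨t, ht, hB⟩
    refine ⟨s * t, mul_pos hs ht, ?_⟩
    rw [Units.val_mul, Matrix.toLin_mul b b b, mul_pow]
    exact hA.comp hB
  one_mem' := ⟨1, one_pos, by simpa using IsScalingOn.id⟩
  inv_mem' := by
    rintro A ⟨t, ht, hA⟩
    refine ⟨t⁻¹, inv_pos.2 ht, ?_⟩
    rw [inv_pow]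
    exact hA.inv ht.ne' (pow_pos ht 2).ne' (toLin_toLin_inv b A) (toLin_inv_toLin b A)

/-- The group of linear maps which act by positive scalars on `L ⧸ Z` and on `Z`. -/
def scalingGL : Subgroup (GL (Fin n) ℝ) where
  carrier := {A | ∃ s > 0, ∃ u > 0, IsScalingOn Z s u (Matrix.toLin b b A)}
  mul_mem' := by
    rintro A B ⟨s, hs, u, hu, hA⟩ ⟨s', hs', u', hu', hB⟩
    refine ⟨s * s', mul_pos hs hs', u * u', mul_pos hu hu', ?_⟩
    rw [Units.val_mul, Matrix.toLin_mul b b b]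
    exact hA.comp hB
  one_mem' := ⟨1, one_pos, 1, one_pos, by simpa using IsScalingOn.id⟩
  inv_mem' := by
    rintro A ⟨s, hs, u, hu, hA⟩
    exact ⟨s⁻¹, inv_pos.2 hs, u⁻¹, inv_pos.2 hu,
      hA.inv hs.ne' hu.ne' (toLin_toLin_inv b A) (toLin_inv_toLin b A)⟩

variable {b Z}

/-- Positive multiples of the identity, as elements of `GL(n)`. -/
def scalarGL (n : ℕ) (r : ℝ) (hr : 0 < r) : GL (Fin n) ℝ where
  val := r • 1
  inv := r⁻¹ • 1
  val_inv := by simp [smul_smul, hr.ne']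
  inv_val := by simp [smul_smul, hr.ne']

lemma posScalars_sup_gradedGL : posScalars n ⊔ gradedGL b Z = scalingGL b Z := by
  refine le_antisymm (sup_le ?_ ?_) ?_
  · rintro A ⟨t, ht, hA⟩
    refine ⟨t, ht, t, ht, ?_⟩
    rw [hA]
    simpa using (IsScalingOn.id (Z := Z)).smul t
  · rintro A ⟨t, ht, hA⟩
    exact ⟨t, ht, t ^ 2, pow_pos ht 2, hA⟩
  · rintro A ⟨s, hs, u, hu, hA⟩
    -- Solving `(s, u) = r (t, t ^ 2)` gives `t = u / s` and `r = s ^ 2 / u`.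
    have hr : 0 < s ^ 2 / u := by positivity
    let c := scalarGL n (s ^ 2 / u) hr
    have hc : c⁻¹ * A ∈ gradedGL b Z := by
      refine ⟨u / s, div_pos hu hs, ?_⟩
      have h : ((c⁻¹ * A : GL (Fin n) ℝ) : Matrix (Fin n) (Fin n) ℝ) =
          (s ^ 2 / u)⁻¹ • (A : Matrix (Fin n) (Fin n) ℝ) := by
        rw [Units.val_mul]
        change ((s ^ 2 / u)⁻¹ • (1 : Matrix (Fin n) (Fin n) ℝ)) * A = _
        rw [Matrix.smul_mul, Matrix.one_mul]
      rw [h, map_smul]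
      convert hA.smul (s ^ 2 / u)⁻¹ using 1 <;> field_simp
    rw [← mul_inv_cancel_left c A]
    exact Subgroup.mul_mem_sup ⟨s ^ 2 / u, hr, rfl⟩ hc

end ScalingGroups

/-- The one-parameter family used to connect a unipotent scaling map to the identity. -/
def scalingPath {R : Type*} [Ring R] [Algebra ℝ R] {P N : R} (hP : P * P = P) (hPN : P * N = N)
    (hNP : N * P = 0) (hN : N * N = 0) (a r : ℝ) : Rˣ where
  val := Real.exp (r * a) • (1 - P) + Real.exp (r * a) ^ 2 • P + r • N
  -- Since `N` maps the part of weight `t` into the part of weight `t ^ 2`, its coefficient in the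
  -- inverse carries `t⁻³`.
  inv := (Real.exp (r * a))⁻¹ • (1 - P) + ((Real.exp (r * a))⁻¹) ^ 2 • P
    - (r * (Real.exp (r * a))⁻¹ ^ 3) • N
  val_inv := by
    have h := (Real.exp_pos (r * a)).ne'
    generalize Real.exp (r * a) = t at *
    simp only [mul_add, add_mul, mul_sub, sub_mul, smul_mul_assoc, mul_smul_comm, one_mul, mul_one,
      hP, hPN, hNP, hN, smul_zero, smul_sub]
    match_scalars <;> field_simp <;> ring
  inv_val := by
    have h := (Real.exp_pos (r * a)).ne'
    generalize Real.exp (r * a) = t at *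
    simp only [mul_add, add_mul, mul_sub, sub_mul, smul_mul_assoc, mul_smul_comm, one_mul, mul_one,
      hP, hPN, hNP, hN, smul_zero, smul_sub, smul_smul, sub_zero]
    match_scalars <;> field_simp <;> ring

lemma continuous_scalingPath {R : Type*} [Ring R] [Algebra ℝ R] [TopologicalSpace R]
    [IsTopologicalRing R] [ContinuousSMul ℝ R] {P N : R} (hP : P * P = P) (hPN : P * N = N)
    (hNP : N * P = 0) (hN : N * N = 0) (a : ℝ) :
    Continuous (scalingPath hP hPN hNP hN a) := by
  have h0 : Continuous fun r : ℝ ↦ Real.exp (r * a) := by fun_prop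
  have h1 : Continuous fun r : ℝ ↦ (Real.exp (r * a))⁻¹ := h0.inv₀ fun r ↦ (Real.exp_pos _).ne'
  refine Units.continuous_iff.2 ⟨?_, ?_⟩
  · change Continuous fun r : ℝ ↦
      Real.exp (r * a) • (1 - P) + Real.exp (r * a) ^ 2 • P + r • N
    fun_prop
  · change Continuous fun r : ℝ ↦ (Real.exp (r * a))⁻¹ • (1 - P) + ((Real.exp (r * a))⁻¹) ^ 2 • P
      - (r * (Real.exp (r * a))⁻¹ ^ 3) • N
    fun_prop

section AutGL

variable {L : Type*} [LieRing L] [LieAlgebra ℝ L] {n : ℕ} {b : Module.Basis (Fin n) ℝ L}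
  {Z : Submodule ℝ L}

/-- The bracket factors through `L ⧸ Z` and takes values in `Z`, so it scales by `t * t`. -/
lemma gradedGL_le_autGL (hZ : ∀ x y : L, ⁅x, y⁆ ∈ Z) (hZ' : ∀ z ∈ Z, ∀ x : L, ⁅z, x⁆ = 0) :
    gradedGL b Z ≤ autGL b := by
  rintro A ⟨t, -, hA⟩ x y
  set f := Matrix.toLin b b A
  have hx : f x = (f x - t • x) + t • x := by abel
  have hy : f y = (f y - t • y) + t • y := by abel
  have hxy (w : L) : ⁅w, f y - t • y⁆ = 0 := by rw [← lie_skew, hZ' _ (hA.1 y), neg_zero]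
  rw [hA.2 _ (hZ x y), hx, hy, add_lie, hZ' _ (hA.1 x), zero_add, lie_add, hxy, zero_add, smul_lie,
    lie_smul, smul_smul, sq]

/-- The identity component of the automorphism group, if the automorphisms close to the identity
act by scalars on `Z` and on `L ⧸ Z`. -/
theorem autGLZero_eq_gradedGL (hZ : ∀ x y : L, ⁅x, y⁆ ∈ Z) (hZ' : ∀ z ∈ Z, ∀ x : L, ⁅z, x⁆ = 0)
    (hrig : ∀ᶠ A in nhds (1 : GL (Fin n) ℝ), A ∈ autGL b → A ∈ gradedGL b Z) :
    autGLZero b = gradedGL b Z := by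
  refine le_antisymm ?_ fun A hA ↦ ?_
  · have h1 : ((gradedGL b Z).subgroupOf (autGL b) : Set (autGL b)) ∈ nhds 1 := by
      have hc : ContinuousAt (Subtype.val : autGL b → GL (Fin n) ℝ) 1 :=
        continuous_subtype_val.continuousAt
      have h := hc.eventually hrig
      filter_upwards [h] with A hA
      exact hA A.2
    have hopen := Subgroup.isOpen_of_mem_nhds _ h1
    have hclopen : IsClopen ((gradedGL b Z).subgroupOf (autGL b) : Set (autGL b)) :=
      ⟨Subgroup.isClosed_of_isOpen _ hopen, hopen⟩
    rintro _ ⟨A, hA, rfl⟩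
    exact hclopen.connectedComponent_subset (one_mem _) hA
  · obtain ⟨t, ht, hAt⟩ := hA
    set f := Matrix.toLin b b A with hf
    -- With a projection `ρ` onto `Z`, `f = t (1 - ρ) + t² ρ + ν`, where `ν` maps `L` into `Z` and
    -- kills `Z`. Replacing `t` by `t ^ r` and `ν` by `r ν` joins the identity to `f` within the
    -- group.
    obtain ⟨g, hg⟩ := LinearMap.exists_leftInverse_of_injective Z.subtype Z.ker_subtype
    let ρ : L →ₗ[ℝ] L := Z.subtype ∘ₗ g
    have hρZ (x : L) : ρ x ∈ Z := (g x).2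
    have hρ (z : L) (hz : z ∈ Z) : ρ z = z := congrArg Subtype.val (LinearMap.congr_fun hg ⟨z, hz⟩)
    let ν : L →ₗ[ℝ] L := f - t • (LinearMap.id - ρ) - t ^ 2 • ρ
    have hνZ (x : L) : ν x ∈ Z := by
      have h : ν x = (f x - t • x) + (t - t ^ 2) • ρ x := by
        simp only [ν, LinearMap.sub_apply, LinearMap.smul_apply, LinearMap.id_apply]
        module
      rw [h]
      exact add_mem (hAt.1 x) (Z.smul_mem _ (hρZ x))
    have hν (z : L) (hz : z ∈ Z) : ν z = 0 := by
      simp [ν, hρ z hz, hAt.2 z hz]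
    have mat (p q : L →ₗ[ℝ] L) : LinearMap.toMatrix b b p * LinearMap.toMatrix b b q =
        LinearMap.toMatrix b b (p ∘ₗ q) := (LinearMap.toMatrix_comp b b b p q).symm
    have hPP : LinearMap.toMatrix b b ρ * LinearMap.toMatrix b b ρ = LinearMap.toMatrix b b ρ := by
      rw [mat]
      congr 1
      ext x
      exact hρ _ (hρZ x)
    have hPN : LinearMap.toMatrix b b ρ * LinearMap.toMatrix b b ν = LinearMap.toMatrix b b ν := by
      rw [mat]
      congr 1
      ext x
      exact hρ _ (hνZ x)
    have hNP : LinearMap.toMatrix b b ν * LinearMap.toMatrix b b ρ = 0 := by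
      rw [mat, ← map_zero (LinearMap.toMatrix b b)]
      congr 1
      ext x
      exact hν _ (hρZ x)
    have hNN : LinearMap.toMatrix b b ν * LinearMap.toMatrix b b ν = 0 := by
      rw [mat, ← map_zero (LinearMap.toMatrix b b)]
      congr 1
      ext x
      exact hν _ (hνZ x)
    let Φ : ℝ → GL (Fin n) ℝ := scalingPath hPP hPN hNP hNN (Real.log t)
    have hΦval (r : ℝ) : Matrix.toLin b b (Φ r) = Real.exp (r * Real.log t) • (LinearMap.id - ρ)
        + Real.exp (r * Real.log t) ^ 2 • ρ + r • ν := by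
      change Matrix.toLin b b (Real.exp (r * Real.log t) • (1 - LinearMap.toMatrix b b ρ)
        + Real.exp (r * Real.log t) ^ 2 • LinearMap.toMatrix b b ρ
        + r • LinearMap.toMatrix b b ν) = _
      simp
    have hΦ (r : ℝ) : Φ r ∈ gradedGL b Z := by
      refine ⟨Real.exp (r * Real.log t), Real.exp_pos _, fun x ↦ ?_, fun z hz ↦ ?_⟩
      · rw [hΦval]
        generalize Real.exp (r * Real.log t) = τ
        have h : (τ • (LinearMap.id - ρ) + τ ^ 2 • ρ + r • ν : L →ₗ[ℝ] L) x - τ • x =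
            (τ ^ 2 - τ) • ρ x + r • ν x := by
          simp only [LinearMap.add_apply, LinearMap.sub_apply, LinearMap.smul_apply,
            LinearMap.id_apply]
          module
        rw [h]
        exact add_mem (Z.smul_mem _ (hρZ x)) (Z.smul_mem _ (hνZ x))
      · rw [hΦval]
        simp [hρ z hz, hν z hz]
    let ψ : ℝ → autGL b := fun r ↦ ⟨Φ r, gradedGL_le_autGL hZ hZ' (hΦ r)⟩
    have hψ : Continuous ψ := (continuous_scalingPath hPP hPN hNP hNN _).subtype_mk _
    have hψ0 : ψ 0 = 1 := by
      refine Subtype.ext (Units.ext ((Matrix.toLin b b).injective ?_))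
      change Matrix.toLin b b (Φ 0) = _
      rw [hΦval]
      simp
    have hψ1 : (ψ 1 : GL (Fin n) ℝ) = A := by
      refine Units.ext ((Matrix.toLin b b).injective ?_)
      change Matrix.toLin b b (Φ 1) = _
      rw [hΦval, one_mul, Real.exp_log ht, one_smul, ← hf]
      simp only [ν]
      module
    refine ⟨ψ 1, ?_, hψ1⟩
    exact (isPreconnected_range hψ).subset_connectedComponent ⟨0, hψ0⟩ ⟨1, rfl⟩

end AutGL

/-! ### Orbits in the symmetric space -/

lemma SymSpace.toMatrix_mk {n : ℕ} (A : GL (Fin n) ℝ) :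
    SymSpace.toMatrix (A : SymSpace n) =
      (A : Matrix (Fin n) (Fin n) ℝ) * (A : Matrix (Fin n) (Fin n) ℝ)ᵀ := rfl

lemma SymSpace.toMatrix_smul {n : ℕ} (φ : GL (Fin n) ℝ) (p : SymSpace n) :
    (φ • p).toMatrix =
      (φ : Matrix (Fin n) (Fin n) ℝ) * p.toMatrix * (φ : Matrix (Fin n) (Fin n) ℝ)ᵀ := by
  induction p using QuotientGroup.induction_on with
  | H A =>
    have h : φ • (A : SymSpace n) = ((φ * A : GL (Fin n) ℝ) : SymSpace n) := rfl
    rw [h, toMatrix_mk, toMatrix_mk, Units.val_mul, Matrix.transpose_mul]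
    simp only [Matrix.mul_assoc]

/-- `GL(n)` acts on the symmetric space by isometries. -/
lemma SymSpace.rdist_smul {n : ℕ} (φ : GL (Fin n) ℝ) (p q : SymSpace n) :
    SymSpace.rdist (φ • p) (φ • q) = SymSpace.rdist p q := by
  have h : ((φ • p).toMatrix⁻¹ * (φ • q).toMatrix).charpoly =
      (p.toMatrix⁻¹ * q.toMatrix).charpoly := by
    have hφ : IsUnit (φ : Matrix (Fin n) (Fin n) ℝ).det := (Matrix.isUnit_iff_isUnit_det _).1 φ.isUnit
    have hφt : IsUnit (φ : Matrix (Fin n) (Fin n) ℝ)ᵀ.det := by rwa [Matrix.det_transpose]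
    obtain ⟨ψ, hψ⟩ := (Matrix.isUnit_iff_isUnit_det _).2 hφt
    rw [toMatrix_smul, toMatrix_smul, Matrix.mul_inv_rev, Matrix.mul_inv_rev, ← hψ]
    -- The matrix `P⁻¹ Q` is only conjugated by `φᵀ`, so its eigenvalues do not change.
    have e : (ψ : Matrix (Fin n) (Fin n) ℝ)⁻¹ * (p.toMatrix⁻¹ * (φ : Matrix (Fin n) (Fin n) ℝ)⁻¹) *
        ((φ : Matrix (Fin n) (Fin n) ℝ) * q.toMatrix * ψ) =
        (ψ : Matrix (Fin n) (Fin n) ℝ)⁻¹ * (p.toMatrix⁻¹ * q.toMatrix) * ψ := by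
      simp only [Matrix.mul_assoc]
      rw [Matrix.nonsing_inv_mul_cancel_left _ _ hφ]
    rw [e, Matrix.charpoly_units_conj']
  rw [rdist, rdist, h]

/-! ### Congruence and non-transitivity for the scaling group -/

section

variable {L : Type*} [AddCommGroup L] [Module ℝ L] {n : ℕ} (b : Module.Basis (Fin n) ℝ L)
  (Z : Submodule ℝ L)

/-- Linear maps which preserve `Z` permute the orbits of the scaling group. -/
lemma smul_orbit_scalingGL {φ : GL (Fin n) ℝ} (hφ : ∀ x, Matrix.toLin b b φ x ∈ Z ↔ x ∈ Z)
    (p : SymSpace n) :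
    φ • MulAction.orbit (scalingGL b Z) p = MulAction.orbit (scalingGL b Z) (φ • p) := by
  have hφ' (x : L) (hx : x ∈ Z) : Matrix.toLin b b (φ⁻¹ : GL (Fin n) ℝ) x ∈ Z := by
    rw [← hφ, toLin_toLin_inv]
    exact hx
  -- Conjugation by a map preserving `Z` keeps both scalars, so `φ` normalizes the scaling group.
  have h1 (A : GL (Fin n) ℝ) (hA : A ∈ scalingGL b Z) : φ * A * φ⁻¹ ∈ scalingGL b Z := by
    obtain ⟨s, hs, u, hu, hA⟩ := hA
    refine ⟨s, hs, u, hu, ?_⟩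
    rw [mul_assoc, Units.val_mul, Units.val_mul, Matrix.toLin_mul b b b, Matrix.toLin_mul b b b]
    exact hA.conj (toLin_toLin_inv b φ) (fun x ↦ (hφ x).2) hφ'
  have h2 (A : GL (Fin n) ℝ) (hA : A ∈ scalingGL b Z) : φ⁻¹ * A * φ ∈ scalingGL b Z := by
    obtain ⟨s, hs, u, hu, hA⟩ := hA
    refine ⟨s, hs, u, hu, ?_⟩
    rw [mul_assoc, Units.val_mul, Units.val_mul, Matrix.toLin_mul b b b, Matrix.toLin_mul b b b]
    exact hA.conj (toLin_inv_toLin b φ) hφ' (fun x ↦ (hφ x).2)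
  ext q
  constructor
  · rintro ⟨_, ⟨⟨A, hA⟩, rfl⟩, rfl⟩
    refine ⟨⟨φ * A * φ⁻¹, h1 A hA⟩, ?_⟩
    change (φ * A * φ⁻¹) • φ • p = φ • A • p
    simp only [smul_smul, inv_mul_cancel_right]
  · rintro ⟨⟨A, hA⟩, rfl⟩
    refine ⟨_, ⟨⟨φ⁻¹ * A * φ, h2 A hA⟩, rfl⟩, ?_⟩
    change φ • (φ⁻¹ * A * φ) • p = A • φ • p
    simp only [smul_smul]
    group

/-- The matrix of a linear isometry of Euclidean space is orthogonal. -/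
lemma exists_orthogonal_toMatrix (k : EuclideanSpace ℝ (Fin n) →ₗᵢ[ℝ] EuclideanSpace ℝ (Fin n)) :
    ∃ K ∈ orthogonalSubgroup n, ∀ v : EuclideanSpace ℝ (Fin n),
      (K : Matrix (Fin n) (Fin n) ℝ) *ᵥ v.ofLp = (k v).ofLp := by
  let e := EuclideanSpace.basisFun (Fin n) ℝ
  let k' := k.toLinearIsometryEquiv rfl
  let M := e.toBasis.toMatrix (e.map k')
  have hM : M ∈ Matrix.orthogonalGroup (Fin n) ℝ := e.toMatrix_orthonormalBasis_mem_unitary _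
  have hM1 : M * star M = 1 := (Matrix.mem_orthogonalGroup_iff _ _).1 hM
  have hM2 : star M * M = 1 := (Matrix.mem_orthogonalGroup_iff' _ _).1 hM
  refine ⟨⟨M, star M, hM1, hM2⟩, hM, fun v ↦ ?_⟩
  ext i
  have hv : k v = ∑ j, v j • k (e j) := by
    conv_lhs => rw [← e.sum_repr v, map_sum]
    simp [e]
  rw [hv]
  simp [M, Matrix.mulVec, dotProduct, Module.Basis.toMatrix_apply, k', e, mul_comm]

lemma toLin_equivFun_symm (M : Matrix (Fin n) (Fin n) ℝ) (v : Fin n → ℝ) :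
    Matrix.toLin b b M (b.equivFun.symm v) = b.equivFun.symm (M *ᵥ v) := by
  apply b.equivFun.injective
  rw [LinearEquiv.apply_symm_apply]
  have h := LinearMap.toMatrix_mulVec_repr b b (Matrix.toLin b b M) (b.equivFun.symm v)
  rw [LinearMap.toMatrix_toLin] at h
  rw [Module.Basis.equivFun_apply, ← h, ← Module.Basis.equivFun_apply, LinearEquiv.apply_symm_apply]

/-- Any two points of the symmetric space are related by a linear map which preserves `Z`. -/
lemma exists_preserving_smul_eq (p q : SymSpace n) :
    ∃ φ : GL (Fin n) ℝ, (∀ x, Matrix.toLin b b φ x ∈ Z ↔ x ∈ Z) ∧ φ • p = q := by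
  induction p using QuotientGroup.induction_on with | H A =>
  induction q using QuotientGroup.induction_on with | H B =>
  let T (C : GL (Fin n) ℝ) : L ≃ₗ[ℝ] L :=
    { Matrix.toLin b b C with
      invFun := Matrix.toLin b b (C⁻¹ : GL (Fin n) ℝ)
      left_inv := toLin_inv_toLin b C
      right_inv := toLin_toLin_inv b C }
  let F₀ : EuclideanSpace ℝ (Fin n) ≃ₗ[ℝ] L :=
    (WithLp.linearEquiv 2 ℝ (Fin n → ℝ)).trans b.equivFun.symm
  let F (C : GL (Fin n) ℝ) : EuclideanSpace ℝ (Fin n) ≃ₗ[ℝ] L := F₀.trans (T C)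
  -- `U C` is `Z` in coordinates orthonormal for the inner product of the coset of `C`. Some `K` in
  -- `O(n)` takes `U A` to `U B`, since the dimensions agree; then `B K A⁻¹` preserves `Z` and sends
  -- the coset of `A` to that of `B`.
  let U (C : GL (Fin n) ℝ) : Submodule ℝ (EuclideanSpace ℝ (Fin n)) :=
    Z.map ((F C).symm : L →ₗ[ℝ] EuclideanSpace ℝ (Fin n))
  have mem_U (C : GL (Fin n) ℝ) (v : EuclideanSpace ℝ (Fin n)) : v ∈ U C ↔ F C v ∈ Z := by
    constructor
    · rintro ⟨z, hz, rfl⟩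
      simpa using hz
    · exact fun h ↦ ⟨_, h, by simp⟩
  have hU (C : GL (Fin n) ℝ) : Module.finrank ℝ (U C) = Module.finrank ℝ Z :=
    LinearEquiv.finrank_map_eq (F C).symm Z
  let ι : U A ≃ₗᵢ[ℝ] U B := (stdOrthonormalBasis ℝ (U A)).equiv (stdOrthonormalBasis ℝ (U B))
    (finCongr ((hU A).trans (hU B).symm))
  let k := ((U B).subtypeₗᵢ.comp ι.toLinearIsometry).extend
  have hk (v : U A) : k v = (ι v : EuclideanSpace ℝ (Fin n)) := LinearIsometry.extend_apply _ v
  have mem_k (v : EuclideanSpace ℝ (Fin n)) : k v ∈ U B ↔ v ∈ U A := by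
    constructor
    · intro h
      obtain ⟨w, hw⟩ := ι.surjective ⟨k v, h⟩
      have h' : k w = k v := by rw [hk, hw]
      rw [← k.injective h']
      exact w.2
    · intro h
      rw [show v = ((⟨v, h⟩ : U A) : EuclideanSpace ℝ (Fin n)) from rfl, hk]
      exact (ι _).2
  obtain ⟨K, hK, hKk⟩ := exists_orthogonal_toMatrix k
  have hφ (v : EuclideanSpace ℝ (Fin n)) :
      Matrix.toLin b b (B * K * A⁻¹ : GL (Fin n) ℝ) (F A v) = F B (k v) := by
    rw [Units.val_mul, Units.val_mul, Matrix.toLin_mul b b b, Matrix.toLin_mul b b b]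
    change Matrix.toLin b b B (Matrix.toLin b b K (Matrix.toLin b b (A⁻¹ : GL (Fin n) ℝ)
      (Matrix.toLin b b A (b.equivFun.symm v.ofLp)))) =
      Matrix.toLin b b B (b.equivFun.symm (k v).ofLp)
    rw [toLin_inv_toLin, toLin_equivFun_symm, hKk]
  refine ⟨B * K * A⁻¹, fun x ↦ ?_, ?_⟩
  · obtain ⟨v, rfl⟩ := (F A).surjective x
    rw [hφ, ← mem_U, ← mem_U, mem_k]
  · change ((B * K * A⁻¹ * A : GL (Fin n) ℝ) : SymSpace n) = B
    rw [inv_mul_cancel_right]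
    exact (QuotientGroup.mk_mul_of_mem B hK)

/-- If `Z` has dimension at least two, the scaling group is not transitive. -/
lemma not_isPretransitive_scalingGL {κ : Type*} (c : Module.Basis κ ℝ L) {i j : κ} (hij : i ≠ j)
    (hi : c i ∈ Z) (hj : c j ∈ Z) :
    ¬ MulAction.IsPretransitive (scalingGL b Z) (SymSpace n) := by
  classical
  intro htrans
  -- `f` doubles `c j` and fixes the other basis vectors. If `h` in the scaling group sends the base
  -- point to the coset of `f`, then `h⁻¹ f` is orthogonal, yet it has eigenvalues `u` and `2 u` on
  -- `c i` and `c j`, and both squares would be 1.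
  let f : L ≃ₗ[ℝ] L := c.equiv (c.unitsSMul fun k ↦ if k = j then Units.mk0 2 two_ne_zero else 1)
    (Equiv.refl κ)
  have hfi : f (c i) = c i := by simp [f, Module.Basis.unitsSMul_apply, hij]
  have hfj : f (c j) = (2 : ℝ) • c j := by
    simp only [f, Module.Basis.equiv_apply, Module.Basis.unitsSMul_apply, Equiv.refl_apply, if_true]
    rfl
  let B : GL (Fin n) ℝ :=
    { val := LinearMap.toMatrix b b f
      inv := LinearMap.toMatrix b b f.symm
      val_inv := by
        rw [← LinearMap.toMatrix_comp, LinearEquiv.comp_coe, LinearEquiv.symm_trans_self]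
        exact LinearMap.toMatrix_id b
      inv_val := by
        rw [← LinearMap.toMatrix_comp, LinearEquiv.comp_coe, LinearEquiv.self_trans_symm]
        exact LinearMap.toMatrix_id b }
  obtain ⟨⟨h, hh⟩, hhB⟩ := htrans.exists_smul_eq ((1 : GL (Fin n) ℝ) : SymSpace n) B
  have hhB' : ((h * 1 : GL (Fin n) ℝ) : SymSpace n) = B := hhB
  rw [mul_one, QuotientGroup.eq] at hhB'
  obtain ⟨s, -, u, -, hu⟩ := inv_mem hh
  have horth (x : L) (r : ℝ) (hx : x ≠ 0)
      (hr : Matrix.toLin b b (h⁻¹ * B : GL (Fin n) ℝ) x = r • x) : r ^ 2 = 1 := by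
    set K : Matrix (Fin n) (Fin n) ℝ := ↑(h⁻¹ * B)
    have hK : Kᵀ * K = 1 := (Matrix.mem_orthogonalGroup_iff' _ _).1 hhB'
    have h1 : K *ᵥ b.equivFun x = r • b.equivFun x := by
      apply b.equivFun.symm.injective
      rw [← toLin_equivFun_symm, map_smul, LinearEquiv.symm_apply_apply, hr]
    have h2 : (K *ᵥ b.equivFun x) ⬝ᵥ (K *ᵥ b.equivFun x) = b.equivFun x ⬝ᵥ b.equivFun x := by
      rw [Matrix.dotProduct_mulVec, ← Matrix.mulVec_transpose, Matrix.mulVec_mulVec, hK,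
        Matrix.one_mulVec]
    have h3 : b.equivFun x ⬝ᵥ b.equivFun x ≠ 0 := by
      rw [Ne, dotProduct_self_eq_zero]
      simpa using hx
    rw [h1, smul_dotProduct, dotProduct_smul, smul_eq_mul, smul_eq_mul, ← mul_assoc] at h2
    rw [sq]
    exact mul_right_cancel₀ h3 (h2.trans (one_mul _).symm)
  have hcomp (x : L) : Matrix.toLin b b (h⁻¹ * B : GL (Fin n) ℝ) x =
      Matrix.toLin b b (h⁻¹ : GL (Fin n) ℝ) (f x) := by
    rw [Units.val_mul, Matrix.toLin_mul_apply b b b]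
    congr 1
    exact LinearMap.congr_fun (Matrix.toLin_toMatrix b b (f : L →ₗ[ℝ] L)) x
  have e1 := horth (c i) u (c.ne_zero i) (by rw [hcomp, hfi, hu.2 _ hi])
  have e2 := horth (c j) (2 * u) (c.ne_zero j)
    (by rw [hcomp, hfj, map_smul, hu.2 _ hj, smul_smul])
  nlinarith

/-- All orbits of the scaling group are congruent. -/
lemma isCongruent_orbit_scalingGL (p q : SymSpace n) :
    SymSpace.IsCongruent (MulAction.orbit (scalingGL b Z) p)
      (MulAction.orbit (scalingGL b Z) q) := by
  obtain ⟨φ, hφ, rfl⟩ := exists_preserving_smul_eq b Z p q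
  exact ⟨φ, SymSpace.rdist_smul φ, smul_orbit_scalingGL b Z hφ p⟩

end

/-! ### The Lie algebra with the bracket `rigidBr` -/

section RigidLieAlgebra

variable {L : Type*} [LieRing L] [LieAlgebra ℝ L] (e : L ≃ₗ[ℝ] E₉)

/-- The center `rigidCenter`, transported to `L`. -/
def centerOf : Submodule ℝ L := rigidCenter.map (e.symm : E₉ →ₗ[ℝ] L)

lemma mem_centerOf {x : L} : x ∈ centerOf e ↔ e x ∈ rigidCenter := by
  constructor
  · rintro ⟨z, hz, rfl⟩
    simpa using hz
  · exact fun h ↦ ⟨_, h, by simp⟩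

variable {e}

lemma lie_mem_centerOf (he : ∀ x y, e ⁅x, y⁆ = rigidBr (e x) (e y))
    (x y : L) : ⁅x, y⁆ ∈ centerOf e := by
  rw [mem_centerOf, he]
  exact rigidBr_mem _ _

lemma lie_eq_zero_of_mem_centerOf (he : ∀ x y, e ⁅x, y⁆ = rigidBr (e x) (e y))
    (z : L) (hz : z ∈ centerOf e) (x : L) : ⁅z, x⁆ = 0 := by
  apply e.injective
  rw [he, rigidBr_eq_zero_of_mem ((mem_centerOf e).1 hz), map_zero]

lemma lowerCentralSeries_one_eq_centerOf (he : ∀ x y, e ⁅x, y⁆ = rigidBr (e x) (e y)) :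
    (LieModule.lowerCentralSeries ℝ L L 1).toSubmodule = centerOf e := by
  rw [LieModule.lowerCentralSeries_succ, LieModule.lowerCentralSeries_zero,
    LieSubmodule.lieIdeal_oper_eq_linear_span', centerOf, rigidCenter_eq_span,
    Submodule.map_span]
  congr 1
  ext z
  constructor
  · rintro ⟨x, -, y, -, rfl⟩
    exact ⟨_, ⟨e x, e y, rfl⟩, by simp [← he]⟩
  · rintro ⟨_, ⟨x, y, rfl⟩, rfl⟩
    refine ⟨e.symm x, LieSubmodule.mem_top _, e.symm y, LieSubmodule.mem_top _, ?_⟩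
    apply e.injective
    simp [he]

lemma isTwoStepOfType_rigid (he : ∀ x y, e ⁅x, y⁆ = rigidBr (e x) (e y)) :
    IsTwoStepOfType L 4 5 := by
  refine ⟨by norm_num, ?_, ?_, ?_⟩
  · rw [LieModule.lowerCentralSeries_succ, LieSubmodule.lie_eq_bot_iff]
    intro x _ y hy
    rw [← LieSubmodule.mem_toSubmodule, lowerCentralSeries_one_eq_centerOf he] at hy
    rw [← lie_skew, lie_eq_zero_of_mem_centerOf he y hy, neg_zero]
  · change Module.finrank ℝ (LieModule.lowerCentralSeries ℝ L L 1).toSubmodule = 4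
    rw [lowerCentralSeries_one_eq_centerOf he, centerOf, LinearEquiv.finrank_map_eq,
      finrank_rigidCenter]
  · rw [e.finrank_eq, finrank_euclideanSpace_fin]

lemma eventually_mem_gradedGL (he : ∀ x y, e ⁅x, y⁆ = rigidBr (e x) (e y))
    (b : Module.Basis (Fin 9) ℝ L) :
    ∀ᶠ A in nhds (1 : GL (Fin 9) ℝ), A ∈ autGL b → A ∈ gradedGL b (centerOf e) := by
  -- `S` is the change of basis from `b` to the basis of `L` corresponding to the standard one,
  -- where the rigidity theorem applies.
  let S : Matrix (Fin 9) (Fin 9) ℝ →ₗ[ℝ] Matrix (Fin 9) (Fin 9) ℝ :=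
    { toFun M := Matrix.of fun k i ↦ e (Matrix.toLin b b M (e.symm (EuclideanSpace.single i 1))) k
      map_add' M N := by ext; simp
      map_smul' c M := by ext; simp }
  have hS : Continuous fun A : GL (Fin 9) ℝ ↦ S A :=
    S.continuous_of_finiteDimensional.comp Units.continuous_val
  have hS1 : S (1 : GL (Fin 9) ℝ) = 1 := by
    ext k i
    simp [S, Matrix.one_apply]
  have hS' : Filter.Tendsto (fun A : GL (Fin 9) ℝ ↦ S A) (nhds 1) (nhds 1) := by
    simpa only [hS1] using hS.tendsto 1
  have h := hS'.eventually eventually_isScalingOn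
  filter_upwards [h] with A hA hAut
  obtain ⟨t, ht, h1, h2⟩ := hA
    ((e : L →ₗ[ℝ] E₉) ∘ₗ Matrix.toLin b b A ∘ₗ (e.symm : E₉ →ₗ[ℝ] L)) (fun i k ↦ rfl)
    (fun x y ↦ by
      have hxy : e.symm (rigidBr x y) = ⁅e.symm x, e.symm y⁆ := by
        apply e.injective
        simp [he]
      have hA' := hAut (e.symm x) (e.symm y)
      simp only [LinearMap.comp_apply, LinearEquiv.coe_coe, hxy, hA', he])
  refine ⟨t, ht, fun x ↦ ?_, fun z hz ↦ ?_⟩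
  · rw [mem_centerOf, map_sub, map_smul]
    simpa using h1 (e x)
  · apply e.injective
    rw [map_smul]
    simpa using h2 (e z) ((mem_centerOf e).1 hz)

/-- The bracket enters the right-hand side only through its center; from here on the problem
concerns a subspace of a vector space. -/
lemma scaledAutZero_eq_scalingGL (he : ∀ x y, e ⁅x, y⁆ = rigidBr (e x) (e y))
    (b : Module.Basis (Fin 9) ℝ L) :
    scaledAutZero b = scalingGL b (centerOf e) := by
  rw [scaledAutZero, autGLZero_eq_gradedGL (lie_mem_centerOf he) (lie_eq_zero_of_mem_centerOf he)
    (eventually_mem_gradedGL he b), posScalars_sup_gradedGL]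

lemma not_isPretransitive_scaledAutZero (he : ∀ x y, e ⁅x, y⁆ = rigidBr (e x) (e y))
    (b : Module.Basis (Fin 9) ℝ L) :
    ¬ MulAction.IsPretransitive (scaledAutZero b) (SymSpace 9) := by
  have hmem (l : Fin 4) : (stdBasis.toBasis.map e.symm) (zIdx l) ∈ centerOf e := by
    rw [mem_centerOf, mem_rigidCenter]
    intro i hi
    have h : i ≠ zIdx l := fun h ↦ by simp [h] at hi
    simp [h]
  rw [scaledAutZero_eq_scalingGL he]
  exact not_isPretransitive_scalingGL b _ _ (i := zIdx 0) (j := zIdx 1) (by decide) (hmem 0)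
    (hmem 1)

lemma isCongruent_orbit_scaledAutZero (he : ∀ x y, e ⁅x, y⁆ = rigidBr (e x) (e y))
    (b : Module.Basis (Fin 9) ℝ L) (p q : SymSpace 9) :
    SymSpace.IsCongruent (MulAction.orbit (scaledAutZero b) p)
      (MulAction.orbit (scaledAutZero b) q) := by
  rw [scaledAutZero_eq_scalingGL he]
  exact isCongruent_orbit_scalingGL b _ p q

end RigidLieAlgebra

/-- The Lie algebra of the group `E₉` is `E₉` with the bracket `rigidBr`. -/
def groupLieAlgebraEquiv : GroupLieAlgebra 𝓘(ℝ, E₉) E₉ ≃ₗ[ℝ] E₉ := LinearEquiv.refl ℝ E₉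

lemma groupLieAlgebraEquiv_lie (x y : GroupLieAlgebra 𝓘(ℝ, E₉) E₉) :
    groupLieAlgebraEquiv ⁅x, y⁆ = rigidBr (groupLieAlgebraEquiv x) (groupLieAlgebraEquiv y) :=
  bracket_eq (E := E₉) x y

theorem theoremA :
    ∃ (G : Type) (_ : TopologicalSpace G) (_ : ChartedSpace (EuclideanSpace ℝ (Fin 9)) G)
      (_ : Group G) (_ : LieGroup 𝓘(ℝ, EuclideanSpace ℝ (Fin 9)) ∞ G),
      ConnectedSpace G ∧ Group.IsNilpotent G ∧
      IsTwoStepOfType (GroupLieAlgebra 𝓘(ℝ, EuclideanSpace ℝ (Fin 9)) G) 4 5 ∧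
      AdmitsRicciSoliton (EuclideanSpace ℝ (Fin 9)) G ∧
      ∀ b : Module.Basis (Fin 9) ℝ (GroupLieAlgebra 𝓘(ℝ, EuclideanSpace ℝ (Fin 9)) G),
        ¬ MulAction.IsPretransitive (scaledAutZero b) (SymSpace 9) ∧
        ∀ p q : SymSpace 9,
          SymSpace.IsCongruent (MulAction.orbit (scaledAutZero b) p) (MulAction.orbit (scaledAutZero b) q) := by
  exact ⟨E₉, inferInstance, inferInstance, inferInstance, inferInstance, inferInstance, isNilpotent,
    isTwoStepOfType_rigid groupLieAlgebraEquiv_lie, admitsRicciSoliton_rigid, fun b ↦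
    ⟨not_isPretransitive_scaledAutZero groupLieAlgebraEquiv_lie b,
      isCongruent_orbit_scaledAutZero groupLieAlgebraEquiv_lie b⟩⟩
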